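/- **Tokuyama's formula.** Let $n\ge 0$, let $\lambda=(\lambda_1\ge\lambda_2\ge\cdots\ge\lambda_n\ge 0)$ be a partition of length at most $n$, let $\delta=(n,n-1,\ldots,1)$, and let $\mu=\lambda+\delta$, a strict partition of length $n$. Let $x_1,\ldots,x_n$ and $t$ be elements of a commutative ring (for example, indeterminates). Let $s_\lambda(x)=\sum_{T}x^{\mathrm{wgt}(T)}$, the sum being over the semistandard tableaux $T$ of shape $\lambda$ with entries in $\{1,\ldots,n\}$ (rows weakly increasing, columns strictly increasing), where $\mathrm{wgt}(T)_k$ is the number of entries $k$ and $x^{w}=x_1^{w_1}\cdots x_n^{w_n}$. Let $\mathcal{ST}^\mu(n)$ be the set of fillings $ST$ with entries in $\{1,\ldots,n\}$ of the shifted diagram of $\mu$ (row $i$ has $\mu_i$ boxes and starts on the main diagonal, in column $i$) that are weakly increasing along rows from left to right, weakly increasing down columns, and strictly increasing down each diagonal from top-left to bottom-right. For such $ST$ and $1\le k\le n$, let $\mathrm{wgt}(ST)_k$ be the number of boxes containing $k$, $\mathrm{row}_k(ST)$ the number of rows containing $k$, and $\mathrm{con}_k(ST)$ the number of connected components of the set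 of boxes containing $k$, where two boxes are adjacent if they share an edge. Put $\mathrm{str}(ST)=\sum_{k=1}^n\mathrm{con}_k(ST)$ and $\mathrm{hgt}(ST)=\sum_{k=1}^n(\mathrm{row}_k(ST)-\mathrm{con}_k(ST))$. Then $\mathrm{hgt}(ST)\ge 0$ and $\mathrm{str}(ST)\ge n$ for every $ST\in\mathcal{ST}^\mu(n)$, and $$\prod_{i=1}^n x_i\ \prod_{1\le i<j\le n}(x_i+t x_j)\ s_\lambda(x)=\sum_{ST\in\mathcal{ST}^\mu(n)}t^{\mathrm{hgt}(ST)}(1+t)^{\mathrm{str}(ST)-n}\,x^{\mathrm{wgt}(ST)}.$$ -/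

import Mathlib

/-! Partitions are Young diagrams (`YoungDiagram`), with rows and columns numbered from `0`.
The letters `1 < 2 < ⋯ < n` are represented by the elements `0 < 1 < ⋯ < n - 1` of `Fin n`. -/

/-- The set `T^lam(n)` of semistandard tableaux of shape `lam` (rows weakly increasing, columns
strictly increasing) with entries in an alphabet of `n` letters. -/
def Tableaux (lam : YoungDiagram) (n : ℕ) : Type :=
  {T : SemistandardYoungTableau lam // ∀ c ∈ lam.cells, T c.1 c.2 < n}

namespace Tableaux

variable {lam : YoungDiagram} {n : ℕ}

instance : Finite (Tableaux lam n) := by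
  refine Finite.of_injective
    (fun T : Tableaux lam n => fun c : lam.cells => (⟨T.1 c.1.1 c.1.2, T.2 c.1 c.2⟩ : Fin n)) ?_
  intro T T' h
  apply Subtype.ext
  ext i j
  by_cases hc : (i, j) ∈ lam
  · have := congrFun h ⟨(i, j), hc⟩
    simpa using this
  · rw [T.1.zeros hc, T'.1.zeros hc]

noncomputable instance : Fintype (Tableaux lam n) := Fintype.ofFinite _

/-- The number of boxes of `T` containing the letter `k`. -/
def wgt (T : Tableaux lam n) (k : Fin n) : ℕ :=
  (lam.cells.filter fun c => T.1 c.1 c.2 = k).card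

end Tableaux

/-- The Schur function `s_lam(x_1, …, x_n)`, as the sum of `x ^ wgt T` over the semistandard
tableaux `T` of shape `lam` with entries in `n` letters. -/
noncomputable def schur {R : Type*} [CommRing R] {n : ℕ} (lam : YoungDiagram) (x : Fin n → R) : R :=
  ∑ T : Tableaux lam n, ∏ k, x k ^ T.wgt k

/-- The boxes of the shifted diagram of `mu`: row `i` of the diagram of `mu` is moved `i` steps to
the right, so that it starts on the main diagonal. -/
def shiftedCells (mu : YoungDiagram) : Finset (ℕ × ℕ) :=
  mu.cells.image fun c => (c.1, c.1 + c.2)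

/-- The set `ST^mu(n)` of semistandard shifted tableaux of shifted shape `mu` (a strict partition)
with entries in an alphabet of `n` letters. -/
@[ext]
structure ShiftedTableau (mu : YoungDiagram) (n : ℕ) where
  /-- the entry in each box (row, column) of the shifted diagram -/
  entry : shiftedCells mu → Fin n
  row_weak : ∀ a b : shiftedCells mu,
    a.1.1 = b.1.1 → a.1.2 < b.1.2 → entry a ≤ entry b
  col_weak : ∀ a b : shiftedCells mu,
    a.1.2 = b.1.2 → a.1.1 < b.1.1 → entry a ≤ entry b
  diag_strict : ∀ (a b : shiftedCells mu) (d : ℕ),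
    0 < d → b.1 = (a.1.1 + d, a.1.2 + d) → entry a < entry b

namespace ShiftedTableau

variable {mu : YoungDiagram} {n : ℕ}

instance : Finite (ShiftedTableau mu n) :=
  Finite.of_injective ShiftedTableau.entry fun _ _ h => ShiftedTableau.ext h

noncomputable instance : Fintype (ShiftedTableau mu n) := Fintype.ofFinite _

/-- The ribbon strip of the letter `k`: the boxes containing `k`. -/
def strip (S : ShiftedTableau mu n) (k : Fin n) : Finset (ℕ × ℕ) :=
  (Finset.univ.filter fun c => S.entry c = k).image Subtype.val

/-- The number of boxes containing the letter `k`. -/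
def wgt (S : ShiftedTableau mu n) (k : Fin n) : ℕ := (S.strip k).card

/-- `row_k`: the number of rows containing the letter `k`. -/
def row (S : ShiftedTableau mu n) (k : Fin n) : ℕ := ((S.strip k).image Prod.fst).card

/-- `con_k`: the number of connected components of the ribbon strip of the letter `k`, two boxes
being adjacent when they share an edge. -/
noncomputable def con (S : ShiftedTableau mu n) (k : Fin n) : ℕ :=
  Nat.card ((SimpleGraph.hasse ℕ □ SimpleGraph.hasse ℕ).induce
    (S.strip k : Set (ℕ × ℕ))).ConnectedComponent

/-- The total number of connected components of all the ribbon strips. -/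
noncomputable def str (S : ShiftedTableau mu n) : ℕ := ∑ k, S.con k

/-- The height `∑ k, (row_k - con_k)`, an integer a priori. -/
noncomputable def hgt (S : ShiftedTableau mu n) : ℤ := ∑ k, ((S.row k : ℤ) - S.con k)

end ShiftedTableau

/-! Both sides are computed by peeling off the largest letter. Removing it from a semistandard
tableau of shape λ leaves a partition interlacing with λ, so s_λ obeys the recursion `branchSchur`
(`schur_eq_branchSchur`). Removing it from a shifted tableau of shape μ leaves a strict partition ν
interlacing with μ, and the removed ribbon strip is weighted row by row. A row with ν_i = μ_i misses
the strip and gives 1. A row with ν_i = μ_{i+1} is joined to the row below, so it adds a row but no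
component, and gives t. Any other row is the bottom of a component and gives 1 + t. The last row
always carries one further component, which accounts for the n subtracted from `str`. This is the
recursion `branchShifted` (`sum_shiftedTableau_eq_branchShifted`).

It remains to compare the recursions (`branchShifted_eq`). A new variable y brings the factor y ∏
(x_i + t y). By the dual Pieri rule (`prod_mul_branchSchur`), multiplying s_κ by ∏ (x_i + u) gives
the sum over vertical strips ρ/κ of u to the number of unchanged rows times s_ρ. For fixed ρ the sum
over the intermediate κ factors over the rows into `stepFactor`s. With u = t y, adding the staircase
turns these into the `ribbonFactor`s.

The dual Pieri rule is proved by induction on the number of variables with the same interchange of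
sums. The two factorised expressions that result agree by a telescoping product. -/

open Finset

/-! ### Branching rule and dual Pieri rule -/

/-- The polynomial defined by the branching rule of Schur functions: the sum runs over the
chains of interlacing partitions. -/
def branchSchur {R : Type*} [CommRing R] : ∀ n : ℕ, (Fin n → ℕ) → (Fin n → R) → R
  | 0, _, _ => 1
  | n + 1, l, x => ∑ k ∈ Fintype.piFinset fun i : Fin n => Icc (l i.succ) (l i.castSucc),
      x (Fin.last n) ^ l (Fin.last n) * (∏ i, x (Fin.last n) ^ (l i.castSucc - k i)) *
        branchSchur n k fun i => x i.castSucc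

/-- The total weight of the intermediate parts between `r` and the interval `[a, b]`. -/
def stepFactor {R : Type*} [CommRing R] (u y : R) (a b r : ℕ) : R :=
  (if r = b + 1 then 1 else if r = a then u else u + y) * y ^ (b - r)

section Algebra

variable {R : Type*} [CommRing R]

/-- Only k = r and k = r - 1 can occur. The first is lost when r = b + 1 and the second when r = a;
otherwise both survive and produce u + y. At r = b + 1 the exponent b - r truncates to 0, as it
should. -/
theorem sum_stepFactor (u y : R) {a b r : ℕ} (hab : a ≤ b) (har : a ≤ r) (hrb : r ≤ b + 1) :
    ∑ k ∈ (Icc a b).filter (fun k => r = k ∨ r = k + 1),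
      (y ^ (b - k) * if r = k then u else 1) = stepFactor u y a b r := by
  unfold stepFactor
  by_cases h1 : r = b + 1
  · have : (Icc a b).filter (fun k => r = k ∨ r = k + 1) = {b} := by
      ext k; simp only [mem_filter, mem_Icc, mem_singleton]; omega
    rw [this, sum_singleton]
    subst h1
    simp
  by_cases h2 : r = a
  · have : (Icc a b).filter (fun k => r = k ∨ r = k + 1) = {a} := by
      ext k; simp only [mem_filter, mem_Icc, mem_singleton]; omega
    rw [this, sum_singleton, if_neg h1, if_pos h2, if_pos h2, h2, mul_comm]
  · obtain ⟨s, rfl⟩ : ∃ s, r = s + 1 := ⟨r - 1, by omega⟩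
    have : (Icc a b).filter (fun k => s + 1 = k ∨ s + 1 = k + 1) = {s, s + 1} := by
      ext k; simp only [mem_filter, mem_Icc, mem_insert, mem_singleton]; omega
    rw [this, sum_pair (by omega), if_neg h1, if_neg h2, if_neg (by omega), if_pos rfl,
      show b - s = (b - (s + 1)) + 1 by omega]
    ring

/-- Formally b i = a i * c i / c (i + 1), and the ratios telescope. Stating the relation without
quotients avoids inverting the c i, which need not be units. -/
theorem prod_eq_mul_prod_of_telescope {n : ℕ} (a : Fin n → R) (b c : Fin (n + 1) → R)
    (h : ∀ i : Fin n, b i.castSucc * c i.succ = c i.castSucc * a i)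
    (hl : b (Fin.last n) = c (Fin.last n)) : ∏ i, b i = c 0 * ∏ i, a i := by
  induction n with
  | zero => simpa using hl
  | succ n ih =>
    rw [Fin.prod_univ_succ, ih (fun i => a i.succ) (fun i => b i.succ) (fun i => c i.succ)
      (fun i => h i.succ) hl, Fin.prod_univ_succ a, ← mul_assoc, ← mul_assoc]
    congr 1
    exact h 0

theorem antitone_of_interlace {n : ℕ} {l : Fin (n + 1) → ℕ} {k : Fin n → ℕ}
    (h : ∀ i, l i.succ ≤ k i ∧ k i ≤ l i.castSucc) : Antitone k := by
  cases n with
  | zero => exact fun i => i.elim0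
  | succ n =>
    rw [Fin.antitone_iff_succ_le]
    exact fun i => (h i.succ).2.trans (h i.castSucc).1

theorem antitone_of_interlace' {n : ℕ} {l : Fin (n + 1) → ℕ} {k : Fin n → ℕ}
    (h : ∀ i, l i.succ ≤ k i ∧ k i ≤ l i.castSucc) : Antitone l := by
  rw [Fin.antitone_iff_succ_le]
  exact fun i => (h i).1.trans (h i).2

open Classical in
/-- Multiplying the branching rule by `∏ (x i + u)`, given the Pieri rule in one variable less. -/
theorem prod_mul_branchSchur_succ {n : ℕ} (u : R) (x : Fin (n + 1) → R)
    (H : ∀ k : Fin n → ℕ, Antitone k →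
      (∏ i : Fin n, (x i.castSucc + u)) * branchSchur n k (fun i => x i.castSucc) =
      ∑ r ∈ (Fintype.piFinset fun i => ({k i, k i + 1} : Finset ℕ)).filter Antitone,
        (∏ i, if r i = k i then u else 1) * branchSchur n r fun i => x i.castSucc)
    (l : Fin (n + 1) → ℕ) (hl : Antitone l) :
    (∏ i : Fin n, (x i.castSucc + u)) * branchSchur (n + 1) l x =
      ∑ r ∈ (Fintype.piFinset fun i : Fin n => Icc (l i.succ) (l i.castSucc + 1)).filter Antitone,
        x (Fin.last n) ^ l (Fin.last n) *
          (∏ i, stepFactor u (x (Fin.last n)) (l i.succ) (l i.castSucc) (r i)) *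
          branchSchur n r fun i => x i.castSucc := by
  rw [branchSchur, mul_sum]
  have e : ∀ k ∈ Fintype.piFinset fun i : Fin n => Icc (l i.succ) (l i.castSucc),
      (∏ i : Fin n, (x i.castSucc + u)) * (x (Fin.last n) ^ l (Fin.last n) *
        (∏ i, x (Fin.last n) ^ (l i.castSucc - k i)) * branchSchur n k fun i => x i.castSucc) =
      ∑ r ∈ (Fintype.piFinset fun i => ({k i, k i + 1} : Finset ℕ)).filter Antitone,
        (∏ i, (x (Fin.last n) ^ (l i.castSucc - k i) * if r i = k i then u else 1)) *
        (x (Fin.last n) ^ l (Fin.last n) * branchSchur n r fun i => x i.castSucc) := by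
    intro k hk
    simp only [Fintype.mem_piFinset, mem_Icc] at hk
    rw [mul_left_comm, H k (antitone_of_interlace hk), mul_sum]
    refine sum_congr rfl fun r _ => ?_
    rw [prod_mul_distrib]
    ring
  rw [sum_congr rfl e]
  -- For fixed r the conditions on k are independent in each coordinate, since interlacing with l
  -- already makes k antitone. Hence the inner sum is a product of one-row sums.
  rw [sum_comm' (t' := (Fintype.piFinset fun i : Fin n =>
      Icc (l i.succ) (l i.castSucc + 1)).filter Antitone)
    (s' := fun r => Fintype.piFinset fun i : Fin n =>
      (Icc (l i.succ) (l i.castSucc)).filter (fun k => r i = k ∨ r i = k + 1))]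
  · refine sum_congr rfl fun r hr => ?_
    simp only [mem_filter, Fintype.mem_piFinset, mem_Icc] at hr
    rw [← sum_mul, ← prod_univ_sum (fun i : Fin n =>
      (Icc (l i.succ) (l i.castSucc)).filter (fun k => r i = k ∨ r i = k + 1))
      (fun i k => x (Fin.last n) ^ (l i.castSucc - k) * if r i = k then u else 1)]
    rw [prod_congr rfl fun i _ => sum_stepFactor u (x (Fin.last n))
      (hl (Fin.castSucc_lt_succ (i := i)).le) (hr.1 i).1 (hr.1 i).2]
    ring
  · intro k r
    simp only [mem_filter, Fintype.mem_piFinset, mem_Icc, mem_insert, mem_singleton]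
    constructor
    · rintro ⟨h1, h2, h3⟩
      exact ⟨fun i => ⟨h1 i, h2 i⟩, fun i => by have := h1 i; have := h2 i; omega, h3⟩
    · rintro ⟨h1, h2, h3⟩
      exact ⟨fun i => (h1 i).1, fun i => (h1 i).2, h3⟩

/-- The total weight of the choices of a part of size `b` or `b + 1` which is at least `r`, and is `b`
if `q` holds. -/
theorem sum_addFactor (u y : R) {b r : ℕ} (q : Prop) [Decidable q] (hrb : r ≤ b + 1)
    (hq : q → r ≤ b) :
    ∑ k ∈ ({b, b + 1} : Finset ℕ).filter (fun k => r ≤ k ∧ (q → k ≤ b)),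
      ((if k = b then u else 1) * y ^ (k - r)) =
      (if r = b + 1 then 1 else if q then u else u + y) * y ^ (b - r) := by
  by_cases h1 : r = b + 1
  · have : ({b, b + 1} : Finset ℕ).filter (fun k => r ≤ k ∧ (q → k ≤ b)) = {b + 1} := by
      ext k
      simp only [mem_filter, mem_insert, mem_singleton]
      by_cases h : q
      · have := hq h; omega
      · simp only [h, false_imp_iff, and_true]; omega
    rw [this, sum_singleton, if_neg (by omega), if_pos h1, h1]
    simp
  by_cases h2 : q
  · have : ({b, b + 1} : Finset ℕ).filter (fun k => r ≤ k ∧ (q → k ≤ b)) = {b} := by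
      ext k; simp only [mem_filter, mem_insert, mem_singleton, h2, true_imp_iff]; omega
    rw [this, sum_singleton, if_neg h1, if_pos h2, if_pos rfl]
  · have : ({b, b + 1} : Finset ℕ).filter (fun k => r ≤ k ∧ (q → k ≤ b)) = {b, b + 1} := by
      ext k
      simp only [mem_filter, mem_insert, mem_singleton, h2, false_imp_iff, and_true]; omega
    rw [this, sum_pair (by omega), if_neg h1, if_neg h2, if_pos rfl, if_neg (by omega),
      show b + 1 - r = (b - r) + 1 by omega]
    ring

open Classical in
/-- The dual Pieri rule: multiplying by `∏ (x i + u)` adds vertical strips. -/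
theorem prod_mul_branchSchur (u : R) : ∀ (n : ℕ) (x : Fin n → R) (l : Fin n → ℕ), Antitone l →
    (∏ i, (x i + u)) * branchSchur n l x =
      ∑ r ∈ (Fintype.piFinset fun i => ({l i, l i + 1} : Finset ℕ)).filter Antitone,
        (∏ i, if r i = l i then u else 1) * branchSchur n r x := by
  intro n
  induction n with
  | zero =>
    intro x l _
    have : (Fintype.piFinset fun i => ({l i, l i + 1} : Finset ℕ)).filter Antitone = {l} := by
      ext r
      simp only [mem_filter, Fintype.mem_piFinset, mem_singleton, Subsingleton.elim r l, iff_true]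
      exact ⟨fun i => i.elim0, fun i => i.elim0⟩
    rw [this]
    simp
  | succ n ih =>
    intro x l hl
    rw [Fin.prod_univ_castSucc, mul_right_comm,
      prod_mul_branchSchur_succ u x (fun k hk => ih (fun i => x i.castSucc) k hk) l hl, sum_mul]
    set y := x (Fin.last n)
    -- Padding k with a last part 0 puts the factor y ^ r n in the same form y ^ (r i - k i) as
    -- those of the other rows.
    have e : ∀ r ∈ (Fintype.piFinset fun i => ({l i, l i + 1} : Finset ℕ)).filter Antitone,
        (∏ i, if r i = l i then u else 1) * branchSchur (n + 1) r x =
        ∑ k ∈ Fintype.piFinset fun i : Fin n => Icc (r i.succ) (r i.castSucc),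
          (∏ i, ((if r i = l i then u else 1) * y ^ (r i - Fin.snoc (α := fun _ => ℕ) k 0 i))) *
            branchSchur n k fun i => x i.castSucc := by
      intro r _
      rw [branchSchur, mul_sum]
      refine sum_congr rfl fun k _ => ?_
      rw [prod_mul_distrib, Fin.prod_univ_castSucc (fun i => y ^ _)]
      simp only [Fin.snoc_castSucc, Fin.snoc_last, Nat.sub_zero]
      ring
    -- Since l (j + 1) ≤ k j and r (j + 1) ≤ l (j + 1) + 1, the condition r (j + 1) ≤ k j can fail
    -- only when k j = l (j + 1). The guarded condition v ≤ l i records exactly this, so for fixed k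
    -- the choices of the parts of r are independent.
    rw [sum_congr rfl e, sum_comm' (t' := (Fintype.piFinset fun i : Fin n =>
      Icc (l i.succ) (l i.castSucc + 1)).filter Antitone)
      (s' := fun k => Fintype.piFinset fun i : Fin (n + 1) =>
        ({l i, l i + 1} : Finset ℕ).filter (fun v => Fin.snoc (α := fun _ => ℕ) k 0 i ≤ v ∧
          ((∃ j : Fin n, j.succ = i ∧ k j = l i) → v ≤ l i)))]
    · refine sum_congr rfl fun k hk => ?_
      simp only [mem_filter, Fintype.mem_piFinset, mem_Icc] at hk
      obtain ⟨hk, hka⟩ := hk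
      have hq : ∀ i : Fin (n + 1), (∃ j : Fin n, j.succ = i ∧ k j = l i) →
          Fin.snoc (α := fun _ => ℕ) k 0 i ≤ l i := by
        rintro _ ⟨j, rfl, hj⟩
        induction h : j.succ using Fin.lastCases with
        | last => simp
        | cast i =>
          rw [Fin.snoc_castSucc, ← h, ← hj]
          exact hka (by rw [Fin.le_iff_val_le_val]; have := congrArg Fin.val h; simp at this; omega)
      have hb : ∀ i : Fin (n + 1), Fin.snoc (α := fun _ => ℕ) k 0 i ≤ l i + 1 := by
        intro i
        induction i using Fin.lastCases with
        | last => simp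
        | cast i => simpa using (hk i).2
      rw [← sum_mul, ← prod_univ_sum (fun i : Fin (n + 1) =>
        ({l i, l i + 1} : Finset ℕ).filter (fun v => Fin.snoc (α := fun _ => ℕ) k 0 i ≤ v ∧
          ((∃ j : Fin n, j.succ = i ∧ k j = l i) → v ≤ l i)))
        (fun i v => (if v = l i then u else 1) * y ^ (v - Fin.snoc (α := fun _ => ℕ) k 0 i)),
        prod_congr rfl fun i _ => sum_addFactor u y _ (hb i) (hq i), prod_mul_distrib,
        Fin.prod_univ_castSucc (fun i => y ^ _)]
      simp only [stepFactor, Fin.snoc_castSucc, Fin.snoc_last, Nat.sub_zero]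
      -- On one side the case k j = l (j + 1) is charged to row j + 1, on the other to row j. The
      -- telescoping moves it by one row and releases the value at row 0, where no row lies above:
      -- this is the missing factor u + y.
      rw [prod_mul_distrib, prod_eq_mul_prod_of_telescope
        (fun i => if k i = l i.castSucc + 1 then 1 else if k i = l i.succ then u else u + y) _
        (fun i => if ∃ j : Fin n, j.succ = i ∧ k j = l i then u else u + y)]
      · rw [if_neg (by rintro ⟨j, hj, _⟩; exact Fin.succ_ne_zero j hj)]
        ring
      · intro i
        have h1 : (∃ j : Fin n, j.succ = i.succ ∧ k j = l i.succ) ↔ k i = l i.succ :=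
          ⟨fun ⟨j, h, h'⟩ => by rw [← Fin.succ_injective _ h]; simpa [h] using h',
            fun h => ⟨i, rfl, h⟩⟩
        simp only [h1, Fin.snoc_castSucc]
        -- Here monotonicity of l excludes k i = l (i + 1), and monotonicity of k excludes equality
        -- of the preceding part with l i, so both correction terms are u + y.
        by_cases h2 : k i = l i.castSucc + 1
        · have h3 : k i ≠ l i.succ := by
            have := hl (Fin.castSucc_lt_succ (i := i)).le
            omega
          have h4 : ¬ ∃ j : Fin n, j.succ = i.castSucc ∧ k j = l i.castSucc := fun h => by
            have := hq _ h
            simp only [Fin.snoc_castSucc] at this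
            omega
          rw [if_pos h2, if_neg h3, if_neg h4, if_pos h2]
          ring
        · rw [if_neg h2, if_neg h2]
      · simp
    · intro r k
      simp only [mem_filter, Fintype.mem_piFinset, mem_Icc, mem_insert, mem_singleton]
      constructor
      · rintro ⟨⟨h1, h2⟩, h3⟩
        refine ⟨fun i => ⟨h1 i, ?_, ?_⟩, fun i => ?_, antitone_of_interlace h3⟩
        · induction i using Fin.lastCases with
          | last => simp
          | cast i => simpa using (h3 i).2
        · rintro ⟨j, rfl, hj⟩
          exact hj ▸ (h3 j).1
        · have := h3 i; have := h1 i.succ; have := h1 i.castSucc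
          omega
      · rintro ⟨h1, h2, h3⟩
        have h4 : ∀ i, r i.succ ≤ k i ∧ k i ≤ r i.castSucc := fun i => by
          refine ⟨?_, by simpa using (h1 i.castSucc).2.1⟩
          have h5 := h1 i.succ
          by_cases h : k i = l i.succ
          · exact h ▸ h5.2.2 ⟨i, rfl, h⟩
          · have := h2 i; omega
        exact ⟨⟨fun i => (h1 i).1, antitone_of_interlace' h4⟩, h4⟩

end Algebra

/-! ### Shifted branching rule and the algebraic form of the identity -/

/-- The weight of a row of a ribbon strip: the row `[v, b)` lies above a row that ends at `a`. -/
def ribbonFactor {R : Type*} [CommRing R] (t y : R) (a b v : ℕ) : R :=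
  (if v = b then 1 else if v = a then t else 1 + t) * y ^ (b - v)

open Classical in
/-- The generating function of the chains of interlacing strict partitions that correspond to
semistandard shifted tableaux. -/
noncomputable def branchShifted {R : Type*} [CommRing R] (t : R) :
    ∀ n : ℕ, (Fin n → ℕ) → (Fin n → R) → R
  | 0, _, _ => 1
  | n + 1, m, x =>
    ∑ v ∈ (Fintype.piFinset fun i : Fin n => Icc (m i.succ) (m i.castSucc)).filter StrictAnti,
      x (Fin.last n) ^ m (Fin.last n) *
        (∏ i, ribbonFactor t (x (Fin.last n)) (m i.succ) (m i.castSucc) (v i)) *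
        branchShifted t n v fun i => x i.castSucc

section Algebra

variable {R : Type*} [CommRing R]

/-- The staircase has one more box in a row than in the next, so the upper end gains 1 over the
lower one. The extra y turns t and 1 + t into t y and t y + y, that is u and u + y for u = t y. -/
theorem ribbonFactor_add (t y : R) {a b r d : ℕ} (hr : r ≤ b + 1) :
    ribbonFactor t y (a + d) (b + 1 + d) (r + d) = stepFactor (t * y) y a b r := by
  unfold ribbonFactor stepFactor
  rw [Nat.add_sub_add_right]
  simp only [Nat.add_right_cancel_iff]
  by_cases h : r = b + 1
  · simp [h]
  · rw [if_neg h, if_neg h, show b + 1 - r = (b - r) + 1 by omega]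
    split_ifs <;> ring

theorem strictAnti_add_staircase {n : ℕ} {r : Fin n → ℕ} :
    StrictAnti (fun i : Fin n => r i + (n - i)) ↔ Antitone r := by
  cases n with
  | zero => exact ⟨fun _ i => i.elim0, fun _ i => i.elim0⟩
  | succ n =>
    rw [Fin.strictAnti_iff_succ_lt, Fin.antitone_iff_succ_le]
    refine forall_congr' fun i => ?_
    have := i.2
    simp only [Fin.val_succ, Fin.val_castSucc]
    omega

/-- Tokuyama's formula in terms of the branching rules. -/
theorem branchShifted_eq (t : R) : ∀ (n : ℕ) (x : Fin n → R) (l : Fin n → ℕ), Antitone l →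
    (∏ i, x i) * (∏ i, ∏ j ∈ Ioi i, (x i + t * x j)) * branchSchur n l x =
      branchShifted t n (fun i => l i + (n - i)) x := by
  intro n
  induction n with
  | zero => intro x l _; simp [branchSchur, branchShifted]
  | succ n ih =>
    intro x l hl
    have hp : ∏ i, ∏ j ∈ Ioi i, (x i + t * x j) =
        (∏ i : Fin n, ∏ j ∈ Ioi i, (x i.castSucc + t * x j.castSucc)) *
          ∏ i : Fin n, (x i.castSucc + t * x (Fin.last n)) := by
      rw [Fin.prod_univ_castSucc, ← prod_mul_distrib]
      have : Ioi (Fin.last n) = ∅ := by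
        ext j; simp [Fin.le_last]
      rw [this, prod_empty, mul_one]
      refine prod_congr rfl fun i _ => ?_
      have : Ioi i.castSucc = insert (Fin.last n) ((Ioi i).map Fin.castSuccEmb) := by
        ext j
        induction j using Fin.lastCases with
        | last => simp [Fin.castSucc_lt_last]
        | cast j => simp [Fin.le_last]
      rw [this, prod_insert (by simp), prod_map, mul_comm]
      rfl
    rw [hp, Fin.prod_univ_castSucc, branchShifted]
    have h := prod_mul_branchSchur_succ (t * x (Fin.last n)) x
      (fun k hk => prod_mul_branchSchur _ n _ k hk) l hl
    -- The pairs involving the last variable are used up by the Pieri step with u = t * x (Fin.last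
    -- n); the remaining pairs belong to the induction hypothesis. The isolated x (Fin.last n)
    -- supplies the staircase box of the last row.
    calc _ = (∏ i : Fin n, x i.castSucc) * x (Fin.last n) *
          (∏ i : Fin n, ∏ j ∈ Ioi i, (x i.castSucc + t * x j.castSucc)) *
          ((∏ i : Fin n, (x i.castSucc + t * x (Fin.last n))) * branchSchur (n + 1) l x) := by ring
      _ = _ := by
        rw [h, mul_sum]
        refine sum_bij' (fun r _ i => r i + (n - i)) (fun v _ i => v i - (n - i)) ?_ ?_ ?_ ?_ ?_
        · intro r hr
          simp only [mem_filter, Fintype.mem_piFinset, mem_Icc] at hr ⊢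
          refine ⟨fun i => ?_, strictAnti_add_staircase.2 hr.2⟩
          have := hr.1 i
          have := i.2
          simp only [Fin.val_succ, Fin.val_castSucc]
          omega
        · intro v hv
          simp only [mem_filter, Fintype.mem_piFinset, mem_Icc] at hv ⊢
          have key : ∀ i : Fin n, l i.succ + (n - i) ≤ v i ∧ v i ≤ l i.castSucc + 1 + (n - i) := by
            intro i
            have := hv.1 i
            have := i.2
            simp only [Fin.val_succ, Fin.val_castSucc] at *
            omega
          refine ⟨fun i => by have := key i; omega, strictAnti_add_staircase.1 ?_⟩
          convert hv.2 using 2 with i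
          have := key i
          omega
        · intro r _
          ext i
          simp
        · intro v hv
          simp only [mem_filter, Fintype.mem_piFinset, mem_Icc] at hv
          ext i
          have := hv.1 i
          have := i.2
          simp only [Fin.val_succ, Fin.val_castSucc] at *
          omega
        · intro r hr
          simp only [mem_filter, Fintype.mem_piFinset, mem_Icc] at hr
          rw [← ih (fun i => x i.castSucc) r hr.2]
          have e : ∀ i : Fin n, ribbonFactor t (x (Fin.last n))
              (l i.succ + (n + 1 - (i.succ : Fin (n + 1)))) (l i.castSucc +
                (n + 1 - (i.castSucc : Fin (n + 1)))) (r i + (n - i)) =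
              stepFactor (t * x (Fin.last n)) (x (Fin.last n)) (l i.succ) (l i.castSucc) (r i) := by
            intro i
            rw [← ribbonFactor_add (d := n - i) t (x (Fin.last n)) (hr.1 i).2]
            have := i.2
            simp only [Fin.val_succ, Fin.val_castSucc]
            congr 1 <;> omega
          rw [prod_congr rfl fun i _ => e i]
          simp only [Fin.val_last, Nat.add_sub_cancel_left, pow_succ]
          ring

end Algebra

/-! ### Young diagrams with prescribed rows, and interlacing -/

theorem lt_card_filter_range_iff {L : ℕ} {p : ℕ → Prop} [DecidablePred p]
    (h : ∀ j k, j ≤ k → k < L → p k → p j) (j : ℕ) :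
    j < ((range L).filter p).card ↔ j < L ∧ p j := by
  induction L with
  | zero => simp
  | succ L ih =>
    have ih' := ih fun j k h1 h2 => h j k h1 (by omega)
    rw [range_add_one, filter_insert]
    split_ifs with hp
    · have : (range L).filter p = range L :=
        filter_true_of_mem fun j hj => h j L (mem_range.1 hj).le (by omega) hp
      rw [card_insert_of_notMem (by simp), this, card_range]
      exact ⟨fun hj => ⟨hj, h j L (by omega) (by omega) hp⟩, fun hj => hj.1⟩
    · rw [ih']
      constructor
      · exact fun h => ⟨by omega, h.2⟩
      · rintro ⟨h1, h2⟩
        refine ⟨lt_of_le_of_ne (by omega) ?_, h2⟩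
        rintro rfl
        exact hp h2

/-- The smallest Young diagram with at least `k i` boxes in row `i`. -/
def diagramOf {n : ℕ} (k : Fin n → ℕ) : YoungDiagram where
  -- The sum only serves as a bound on the columns that keeps the set finite.
  cells := (range n ×ˢ range (∑ i, k i)).filter fun c => ∃ i : Fin n, c.1 ≤ i ∧ c.2 < k i
  isLowerSet := by
    rintro ⟨a, b⟩ ⟨a', b'⟩ ⟨h1, h2⟩ h
    simp only [coe_filter, mem_product, mem_range, Set.mem_ofPred_eq] at h h1 h2 ⊢
    obtain ⟨⟨h3, h4⟩, i, h5, h6⟩ := h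
    exact ⟨⟨by omega, by omega⟩, i, by omega, by omega⟩

section Diagram

variable {n : ℕ} {k : Fin n → ℕ}

theorem mem_diagramOf (hk : Antitone k) {i j : ℕ} :
    (i, j) ∈ diagramOf k ↔ ∃ h : i < n, j < k ⟨i, h⟩ := by
  rw [← YoungDiagram.mem_cells]
  simp only [diagramOf, mem_filter, mem_product, mem_range]
  constructor
  · rintro ⟨⟨h, _⟩, i', h1, h2⟩
    exact ⟨h, h2.trans_le (hk (show (⟨i, h⟩ : Fin n) ≤ i' from h1))⟩
  · rintro ⟨h, h1⟩
    exact ⟨⟨h, h1.trans_le (single_le_sum (fun _ _ => Nat.zero_le _) (mem_univ _))⟩,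
      ⟨i, h⟩, le_rfl, h1⟩

theorem rowLen_diagramOf (hk : Antitone k) (i : Fin n) : (diagramOf k).rowLen i = k i := by
  refine eq_of_forall_lt_iff fun j => ?_
  rw [← YoungDiagram.mem_iff_lt_rowLen, mem_diagramOf hk]
  exact ⟨fun ⟨_, h⟩ => h, fun h => ⟨i.2, h⟩⟩

theorem rowLen_diagramOf_eq_zero (hk : Antitone k) {i : ℕ} (hi : n ≤ i) :
    (diagramOf k).rowLen i = 0 := by
  by_contra h
  have := (mem_diagramOf hk).1 (YoungDiagram.mem_iff_lt_rowLen.2 (Nat.pos_of_ne_zero h))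
  obtain ⟨h1, _⟩ := this
  omega

theorem YoungDiagram.card_eq_sum_rowLen (m : YoungDiagram) {N : ℕ} (h : m.rowLen N = 0) :
    m.cells.card = ∑ i : Fin N, m.rowLen i := by
  rw [Fin.sum_univ_eq_sum_range (fun i => m.rowLen i) N,
    card_eq_sum_card_fiberwise (f := Prod.fst) (t := range N)]
  · refine sum_congr rfl fun i _ => ?_
    rw [YoungDiagram.rowLen_eq_card]
    rfl
  · rintro ⟨i, j⟩ hc
    simp only [coe_range, Set.mem_Iio]
    by_contra hi
    have h1 := YoungDiagram.mem_iff_lt_rowLen.1 ((YoungDiagram.mem_cells _).1 hc)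
    have h2 := m.rowLen_anti N i (by omega)
    omega

end Diagram

section Interlace

variable {n : ℕ} {m : YoungDiagram} {k : Fin n → ℕ}

theorem antitone_of_interlace_rowLen
    (hi : ∀ i : Fin n, m.rowLen (i + 1) ≤ k i ∧ k i ≤ m.rowLen i) : Antitone k :=
  antitone_of_interlace (l := fun i : Fin (n + 1) => m.rowLen i) (by simpa using hi)

theorem mem_of_mem_diagramOf (hi : ∀ i : Fin n, m.rowLen (i + 1) ≤ k i ∧ k i ≤ m.rowLen i)
    {i j : ℕ} (h : (i, j) ∈ diagramOf k) : (i, j) ∈ m := by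
  obtain ⟨h1, h2⟩ := (mem_diagramOf (antitone_of_interlace_rowLen hi)).1 h
  rw [YoungDiagram.mem_iff_lt_rowLen]
  exact h2.trans_le (hi ⟨i, h1⟩).2

/-- Interlacing means that the boxes outside the inner diagram form a horizontal strip: at most one
in each column, and at its bottom. -/
theorem mem_diagramOf_of_lt (hm : m.rowLen (n + 1) = 0)
    (hi : ∀ i : Fin n, m.rowLen (i + 1) ≤ k i ∧ k i ≤ m.rowLen i)
    {i i' j : ℕ} (hii : i < i') (h : (i', j) ∈ m) : (i, j) ∈ diagramOf k := by
  rw [YoungDiagram.mem_iff_lt_rowLen] at h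
  have h1 : i < n := by
    by_contra hn
    have := m.rowLen_anti (n + 1) i' (by omega)
    omega
  rw [mem_diagramOf (antitone_of_interlace_rowLen hi)]
  have h2 := m.rowLen_anti (i + 1) i' (by omega)
  have h3 := (hi ⟨i, h1⟩).1
  exact ⟨h1, by simp only at h3; omega⟩

theorem card_sdiff_diagramOf (hm : m.rowLen (n + 1) = 0)
    (hi : ∀ i : Fin n, m.rowLen (i + 1) ≤ k i ∧ k i ≤ m.rowLen i) :
    m.cells.card = (diagramOf k).cells.card + (m.rowLen n + ∑ i : Fin n, (m.rowLen i - k i)) := by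
  have hk := antitone_of_interlace_rowLen hi
  rw [m.card_eq_sum_rowLen hm,
    (diagramOf k).card_eq_sum_rowLen (rowLen_diagramOf_eq_zero hk le_rfl),
    Fin.sum_univ_castSucc]
  simp only [rowLen_diagramOf hk, Fin.val_castSucc, Fin.val_last]
  have : ∑ i : Fin n, m.rowLen i = ∑ i, k i + ∑ i : Fin n, (m.rowLen i - k i) := by
    rw [← sum_add_distrib]
    exact sum_congr rfl fun i _ => by have := hi i; omega
  omega

end Interlace

/-! ### Removing and adding the largest letter in semistandard tableaux -/

namespace Tableaux

variable {n : ℕ} {lam : YoungDiagram} {k : Fin n → ℕ}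

/-- The part of a tableau filled with all letters but the largest one. -/
def restrict (T : Tableaux lam (n + 1)) (hk : Antitone k)
    (hT : ∀ i : Fin n, ∀ j, j < k i ↔ j < lam.rowLen i ∧ T.1 i j < n) :
    Tableaux (diagramOf k) n :=
  ⟨{ entry := fun i j => if (i, j) ∈ diagramOf k then T.1 i j else 0
     row_weak' := by
       intro i j1 j2 hj h
       rw [if_pos h, if_pos ((diagramOf k).up_left_mem le_rfl hj.le h)]
       obtain ⟨h1, h2⟩ := (mem_diagramOf hk).1 h
       exact T.1.row_weak hj (YoungDiagram.mem_iff_lt_rowLen.2 ((hT ⟨i, h1⟩ j2).1 h2).1)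
     col_strict' := by
       intro i1 i2 j hi h
       rw [if_pos h, if_pos ((diagramOf k).up_left_mem hi.le le_rfl h)]
       obtain ⟨h1, h2⟩ := (mem_diagramOf hk).1 h
       exact T.1.col_strict hi (YoungDiagram.mem_iff_lt_rowLen.2 ((hT ⟨i2, h1⟩ j).1 h2).1)
     zeros' := fun h => if_neg h },
   fun c hc => by
     obtain ⟨i, j⟩ := c
     have h := (YoungDiagram.mem_cells _).1 hc
     obtain ⟨h1, h2⟩ := (mem_diagramOf hk).1 h
     change (if (i, j) ∈ diagramOf k then T.1 i j else 0) < n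
     rw [if_pos h]
     exact ((hT ⟨i, h1⟩ j).1 h2).2⟩

/-- Filling the boxes of `lam` outside of a smaller tableau with a new largest letter. -/
def extend (T : Tableaux (diagramOf k) n) (hm : lam.rowLen (n + 1) = 0)
    (hi : ∀ i : Fin n, lam.rowLen (i + 1) ≤ k i ∧ k i ≤ lam.rowLen i) :
    Tableaux lam (n + 1) :=
  ⟨{ entry := fun i j => if (i, j) ∈ diagramOf k then T.1 i j else if (i, j) ∈ lam then n else 0
     row_weak' := by
       intro i j1 j2 hj h
       by_cases h2 : (i, j2) ∈ diagramOf k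
       · rw [if_pos h2, if_pos ((diagramOf k).up_left_mem le_rfl hj.le h2)]
         exact T.1.row_weak hj h2
       · rw [if_neg h2, if_pos h]
         split_ifs with h3
         · exact (T.2 _ ((YoungDiagram.mem_cells _).2 h3)).le
         · exact le_rfl
         · exact Nat.zero_le _
     col_strict' := by
       intro i1 i2 j hii h
       have h1 := mem_diagramOf_of_lt hm hi hii h
       rw [if_pos h1]
       split_ifs with h2
       · exact T.1.col_strict hii h2
       · exact T.2 _ ((YoungDiagram.mem_cells _).2 h1)
     zeros' := fun h => by
       rw [if_neg fun h' => h (mem_of_mem_diagramOf hi h'), if_neg h] },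
   fun c hc => by
     obtain ⟨i, j⟩ := c
     change (if (i, j) ∈ diagramOf k then T.1 i j else if (i, j) ∈ lam then n else 0) < n + 1
     split_ifs with h1 h2
     · exact (T.2 _ ((YoungDiagram.mem_cells _).2 h1)).trans (Nat.lt_succ_self n)
     · exact Nat.lt_succ_self n
     · exact Nat.succ_pos n⟩

theorem extend_apply (T : Tableaux (diagramOf k) n) (hm : lam.rowLen (n + 1) = 0)
    (hi : ∀ i : Fin n, lam.rowLen (i + 1) ≤ k i ∧ k i ≤ lam.rowLen i) (i j : ℕ) :
    (extend T hm hi).1 i j =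
      if (i, j) ∈ diagramOf k then T.1 i j else if (i, j) ∈ lam then n else 0 := rfl

theorem restrict_apply (T : Tableaux lam (n + 1)) (hk : Antitone k)
    (hT : ∀ i : Fin n, ∀ j, j < k i ↔ j < lam.rowLen i ∧ T.1 i j < n) (i j : ℕ) :
    (restrict T hk hT).1 i j = if (i, j) ∈ diagramOf k then T.1 i j else 0 := rfl

/-- The lengths of the rows of the part of `T` without the letter `n`. -/
def innerShape (T : Tableaux lam (n + 1)) (i : Fin n) : ℕ :=
  ((range (lam.rowLen i)).filter fun j => T.1 i j < n).card

theorem lt_innerShape_iff (T : Tableaux lam (n + 1)) (i : Fin n) (j : ℕ) :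
    j < T.innerShape i ↔ j < lam.rowLen i ∧ T.1 i j < n :=
  lt_card_filter_range_iff (fun _ _ h1 h2 h3 => (T.1.row_weak_of_le h1
    (YoungDiagram.mem_iff_lt_rowLen.2 h2)).trans_lt h3) j

theorem innerShape_interlace (T : Tableaux lam (n + 1)) (i : Fin n) :
    lam.rowLen (i + 1) ≤ T.innerShape i ∧ T.innerShape i ≤ lam.rowLen i := by
  constructor
  · refine le_of_forall_lt fun j hj => ?_
    have h := YoungDiagram.mem_iff_lt_rowLen.2 hj
    rw [lt_innerShape_iff]
    refine ⟨hj.trans_le (lam.rowLen_anti _ _ (Nat.le_succ _)), ?_⟩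
    exact (T.1.col_strict (Nat.lt_succ_self _) h).trans_le
      (Nat.lt_succ_iff.1 (T.2 _ ((YoungDiagram.mem_cells _).2 h)))
  · exact le_of_forall_lt fun j hj => ((lt_innerShape_iff T i j).1 hj).1

theorem extend_eq_iff (T : Tableaux (diagramOf k) n) (hm : lam.rowLen (n + 1) = 0)
    (hi : ∀ i : Fin n, lam.rowLen (i + 1) ≤ k i ∧ k i ≤ lam.rowLen i) (i : Fin n) (j : ℕ) :
    j < k i ↔ j < lam.rowLen i ∧ (extend T hm hi).1 i j < n := by
  have hk := antitone_of_interlace_rowLen hi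
  have h0 : ((i : ℕ), j) ∈ diagramOf k ↔ j < k i := by
    rw [mem_diagramOf hk]
    exact ⟨fun ⟨_, h⟩ => h, fun h => ⟨i.2, h⟩⟩
  rw [extend_apply, ← h0, ← YoungDiagram.mem_iff_lt_rowLen]
  constructor
  · intro h
    rw [if_pos h]
    exact ⟨mem_of_mem_diagramOf hi h, T.2 _ ((YoungDiagram.mem_cells _).2 h)⟩
  · rintro ⟨h1, h2⟩
    by_contra h
    rw [if_neg h, if_pos h1] at h2
    exact lt_irrefl _ h2

theorem wgt_extend_castSucc (T : Tableaux (diagramOf k) n) (hm : lam.rowLen (n + 1) = 0)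
    (hi : ∀ i : Fin n, lam.rowLen (i + 1) ≤ k i ∧ k i ≤ lam.rowLen i) (a : Fin n) :
    (extend T hm hi).wgt a.castSucc = T.wgt a := by
  unfold wgt
  congr 1
  ext ⟨i, j⟩
  rw [mem_filter, mem_filter]
  simp only [extend_apply, YoungDiagram.mem_cells, Fin.val_castSucc]
  have := a.2
  constructor
  · rintro ⟨h1, h2⟩
    by_cases h : (i, j) ∈ diagramOf k
    · rw [if_pos h] at h2
      exact ⟨h, h2⟩
    · rw [if_neg h, if_pos h1] at h2
      omega
  · rintro ⟨h1, h2⟩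
    exact ⟨mem_of_mem_diagramOf hi h1, by rw [if_pos h1, h2]⟩

theorem wgt_extend_last (T : Tableaux (diagramOf k) n) (hm : lam.rowLen (n + 1) = 0)
    (hi : ∀ i : Fin n, lam.rowLen (i + 1) ≤ k i ∧ k i ≤ lam.rowLen i) :
    (extend T hm hi).wgt (Fin.last n) = lam.rowLen n + ∑ i : Fin n, (lam.rowLen i - k i) := by
  have h : (extend T hm hi).wgt (Fin.last n) = (lam.cells \ (diagramOf k).cells).card := by
    unfold wgt
    congr 1
    ext ⟨i, j⟩
    rw [mem_filter, mem_sdiff]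
    simp only [extend_apply, YoungDiagram.mem_cells, Fin.val_last]
    refine and_congr_right fun h1 => ?_
    by_cases h : (i, j) ∈ diagramOf k
    · have := T.2 _ ((YoungDiagram.mem_cells _).2 h)
      simp only at this
      simp only [h, if_true, not_true, iff_false]
      omega
    · simp [h, h1]
  rw [h, card_sdiff_of_subset, card_sdiff_diagramOf hm hi, Nat.add_sub_cancel_left]
  rintro ⟨i, j⟩ h
  exact (YoungDiagram.mem_cells _).2 (mem_of_mem_diagramOf hi ((YoungDiagram.mem_cells _).1 h))

theorem extend_restrict (T : Tableaux lam (n + 1)) (hk : Antitone k)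
    (hT : ∀ i : Fin n, ∀ j, j < k i ↔ j < lam.rowLen i ∧ T.1 i j < n)
    (hm : lam.rowLen (n + 1) = 0)
    (hi : ∀ i : Fin n, lam.rowLen (i + 1) ≤ k i ∧ k i ≤ lam.rowLen i) :
    extend (restrict T hk hT) hm hi = T := by
  apply Subtype.ext
  ext i j
  rw [extend_apply, restrict_apply]
  split_ifs with h1 h2
  · rfl
  · have h3 := T.2 _ ((YoungDiagram.mem_cells _).2 h2)
    refine (le_antisymm (Nat.lt_succ_iff.1 h3) (not_lt.1 fun h4 => h1 ?_)).symm
    simp only at h4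
    rw [mem_diagramOf hk]
    rw [YoungDiagram.mem_iff_lt_rowLen] at h2
    have hin : i < n := by
      by_contra hn
      have h5 : i = n := by
        by_contra h6
        have := lam.rowLen_anti (n + 1) i (by omega)
        omega
      subst h5
      -- Strict columns force the entries of row a to be at least a. Hence row n, on which the inner
      -- shape has no part, contains only the largest letter.
      have : ∀ a ≤ i, a ≤ T.1 a j := by
        intro a
        induction a with
        | zero => exact fun _ => Nat.zero_le _
        | succ a ih =>
          intro ha
          have := ih (by omega)
          have h7 : (a + 1, j) ∈ lam := lam.up_left_mem ha le_rfl
            (YoungDiagram.mem_iff_lt_rowLen.2 h2)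
          have := T.1.col_strict (Nat.lt_add_one a) h7
          omega
      have := this i le_rfl
      omega
    exact ⟨hin, (hT ⟨i, hin⟩ j).2 ⟨h2, h4⟩⟩
  · exact (T.1.zeros h2).symm

theorem restrict_extend (T : Tableaux (diagramOf k) n) (hm : lam.rowLen (n + 1) = 0)
    (hi : ∀ i : Fin n, lam.rowLen (i + 1) ≤ k i ∧ k i ≤ lam.rowLen i) (hk : Antitone k) :
    restrict (extend T hm hi) hk (extend_eq_iff T hm hi) = T := by
  apply Subtype.ext
  ext i j
  rw [restrict_apply, extend_apply]
  split_ifs with h1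
  · rfl
  · exact (T.1.zeros h1).symm

end Tableaux

/-- Schur functions satisfy the branching rule. -/
theorem schur_eq_branchSchur {R : Type*} [CommRing R] (n : ℕ) : ∀ (lam : YoungDiagram)
    (_ : lam.rowLen n = 0) (x : Fin n → R),
    schur lam x = branchSchur n (fun i => lam.rowLen i) x := by
  induction n with
  | zero =>
    intro lam h x
    have h0 : ∀ c, c ∉ lam := by
      rintro ⟨i, j⟩ hc
      have := lam.rowLen_anti 0 i (Nat.zero_le i)
      rw [YoungDiagram.mem_iff_lt_rowLen] at hc
      omega
    have : Fintype.card (Tableaux lam 0) = 1 := by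
      refine Fintype.card_eq_one_iff.2 ⟨⟨⟨fun _ _ => 0, fun _ h => (h0 _ h).elim,
        fun _ h => (h0 _ h).elim, fun _ => rfl⟩, fun c hc =>
          (h0 c ((YoungDiagram.mem_cells _).1 hc)).elim⟩, fun T => Subtype.ext ?_⟩
      ext i j
      rw [T.1.zeros (h0 _)]
      rfl
    simp [schur, branchSchur, this]
  | succ n ih =>
    intro lam hm x
    classical
    -- The tableaux are grouped by the shape left after removing the largest letter; each fibre is
    -- in bijection with the tableaux of that shape.
    rw [branchSchur, schur, ← sum_fiberwise_of_maps_to (g := Tableaux.innerShape)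
      (t := Fintype.piFinset fun i : Fin n =>
        Icc (lam.rowLen (i.succ : Fin (n + 1))) (lam.rowLen (i.castSucc : Fin (n + 1))))]
    · refine sum_congr rfl fun k hk => ?_
      have hi : ∀ i : Fin n, lam.rowLen (i + 1) ≤ k i ∧ k i ≤ lam.rowLen i := by
        simpa only [Fintype.mem_piFinset, mem_Icc, Fin.val_succ, Fin.val_castSucc] using hk
      have hka := antitone_of_interlace_rowLen hi
      have e : branchSchur n k (fun i => x i.castSucc) =
          schur (diagramOf k) fun i => x i.castSucc := by
        rw [ih _ (rowLen_diagramOf_eq_zero hka le_rfl)]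
        congr 1
        ext i
        rw [rowLen_diagramOf hka]
      rw [e, schur, mul_sum]
      have hS : ∀ T ∈ univ.filter (fun T : Tableaux lam (n + 1) => T.innerShape = k),
          ∀ i : Fin n, ∀ j, j < k i ↔ j < lam.rowLen i ∧ T.1 i j < n := by
        intro T hT i j
        rw [← T.lt_innerShape_iff, (mem_filter.1 hT).2]
      have hE : ∀ T : Tableaux (diagramOf k) n, (T.extend hm hi).innerShape = k := by
        intro T
        ext i
        refine eq_of_forall_lt_iff fun j => ?_
        rw [Tableaux.lt_innerShape_iff, ← Tableaux.extend_eq_iff]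
      refine sum_bij' (fun T hT => T.restrict hka (hS T hT)) (fun T _ => T.extend hm hi)
        (fun _ _ => mem_univ _) (fun T _ => mem_filter.2 ⟨mem_univ _, hE T⟩)
        (fun T hT => T.extend_restrict hka (hS T hT) hm hi)
        (fun T _ => T.restrict_extend hm hi hka) fun T hT => ?_
      conv_lhs => rw [← T.extend_restrict hka (hS T hT) hm hi]
      rw [Fin.prod_univ_castSucc, Tableaux.wgt_extend_last]
      simp only [Tableaux.wgt_extend_castSucc]
      rw [prod_pow_eq_pow_sum, pow_add]
      simp only [Fin.val_last, Fin.val_castSucc]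
      ring
    · intro T _
      simpa only [Fintype.mem_piFinset, mem_Icc, Fin.val_succ, Fin.val_castSucc] using
        T.innerShape_interlace

/-! ### Connected components of ribbon strips -/

/-- The square grid, in which two boxes are adjacent when they share an edge. -/
abbrev squareGrid : SimpleGraph (ℕ × ℕ) := SimpleGraph.hasse ℕ □ SimpleGraph.hasse ℕ

theorem squareGrid_adj {a b : ℕ × ℕ} : squareGrid.Adj a b ↔
    ((a.1 + 1 = b.1 ∨ b.1 + 1 = a.1) ∧ a.2 = b.2) ∨
      ((a.2 + 1 = b.2 ∨ b.2 + 1 = a.2) ∧ a.1 = b.1) := by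
  simp only [SimpleGraph.boxProd_adj, SimpleGraph.hasse_adj, Order.covBy_iff_add_one_eq]

section Components

variable {N : ℕ} {lo hi : ℕ → ℕ} {s : Finset (ℕ × ℕ)}

theorem reachable_row_start (hs : ∀ i j, (i, j) ∈ s ↔ i ≤ N ∧ lo i ≤ j ∧ j < hi i)
    {i : ℕ} (h0 : (i, lo i) ∈ s) : ∀ (d : ℕ) (h : (i, lo i + d) ∈ s),
    (squareGrid.induce (s : Set (ℕ × ℕ))).Reachable ⟨_, h⟩ ⟨_, h0⟩ := by
  intro d
  induction d with
  | zero => exact fun h => SimpleGraph.Reachable.refl _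
  | succ d ih =>
    intro h
    have h1 := (hs _ _).1 h
    have h2 : (i, lo i + d) ∈ s := (hs _ _).2 ⟨h1.1, by omega, by omega⟩
    refine SimpleGraph.Reachable.trans (SimpleGraph.Adj.reachable ?_) (ih h2)
    rw [SimpleGraph.induce_adj, squareGrid_adj]
    exact Or.inr ⟨Or.inr rfl, rfl⟩

/-- In a skew shape without `2 × 2` squares, every row is connected to a row without boxes
directly below it. -/
theorem exists_reachable_bottom_row (hs : ∀ i j, (i, j) ∈ s ↔ i ≤ N ∧ lo i ≤ j ∧ j < hi i)
    (h1 : ∀ i < N, hi (i + 1) ≤ lo i + 1)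
    (h2 : ∀ i < N, hi (i + 1) = lo i + 1 → lo (i + 1) ≤ lo i) :
    ∀ (m i : ℕ) (_ : i + m = N) (h : (i, lo i) ∈ s), ∃ d, ∃ h' : (d, lo d) ∈ s,
      (d < N → hi (d + 1) ≤ lo d) ∧
      (squareGrid.induce (s : Set (ℕ × ℕ))).Reachable ⟨_, h'⟩ ⟨_, h⟩ := by
  intro m
  induction m with
  | zero => exact fun i hi h => ⟨i, h, by omega, SimpleGraph.Reachable.refl _⟩
  | succ m ih =>
    intro i hm h
    -- If row i is not a bottom row, then `hi (i + 1) = lo i + 1`, so the last box of row i + 1 lies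
    -- directly below the first box of row i, and the descent continues from there.
    by_cases hd : hi (i + 1) ≤ lo i
    · exact ⟨i, h, fun _ => hd, SimpleGraph.Reachable.refl _⟩
    · have e1 := h1 i (by omega)
      have e2 := h2 i (by omega) (by omega)
      have h3 : (i + 1, lo i) ∈ s := (hs _ _).2 ⟨by omega, e2, by omega⟩
      have h4 : (i + 1, lo (i + 1)) ∈ s := (hs _ _).2 ⟨by omega, le_rfl, by omega⟩
      obtain ⟨d, h5, h6, h7⟩ := ih (i + 1) (by omega) h4
      refine ⟨d, h5, h6, h7.trans ?_⟩
      obtain ⟨c, hc⟩ := Nat.exists_eq_add_of_le e2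
      have h8 : (i + 1, lo (i + 1) + c) ∈ s := hc ▸ h3
      refine (reachable_row_start hs h4 c h8).symm.trans (SimpleGraph.Adj.reachable ?_)
      rw [SimpleGraph.induce_adj, squareGrid_adj]
      exact Or.inl ⟨Or.inr rfl, hc.symm⟩

/-- An edge from row d to row d + 1 would need a common column j with lo d ≤ j < hi (d + 1), so no
path can pass below row d. Hence a component has at most one bottom row. -/
theorem row_le_of_reachable (hs : ∀ i j, (i, j) ∈ s ↔ i ≤ N ∧ lo i ≤ j ∧ j < hi i)
    {d : ℕ} (hd : d < N → hi (d + 1) ≤ lo d) {a b : (s : Set (ℕ × ℕ))}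
    (h : (squareGrid.induce (s : Set (ℕ × ℕ))).Reachable a b) (ha : a.1.1 ≤ d) :
    b.1.1 ≤ d := by
  rw [SimpleGraph.reachable_iff_reflTransGen] at h
  induction h with
  | refl => exact ha
  | @tail b c _ hbc ih =>
    rw [SimpleGraph.induce_adj, squareGrid_adj] at hbc
    obtain ⟨⟨i, j⟩, hb⟩ := b
    obtain ⟨⟨i', j'⟩, hc⟩ := c
    have hb := (hs _ _).1 hb
    have hc := (hs _ _).1 hc
    simp only at hbc ih ⊢
    by_contra hlt
    obtain ⟨rfl, rfl, rfl⟩ : i' = d + 1 ∧ i = d ∧ j = j' := by omega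
    have := hd (by omega)
    omega

/-- The connected components of a skew shape without `2 × 2` squares correspond to the nonempty
rows without boxes directly below them. -/
theorem card_connectedComponent (hs : ∀ i j, (i, j) ∈ s ↔ i ≤ N ∧ lo i ≤ j ∧ j < hi i)
    (h1 : ∀ i < N, hi (i + 1) ≤ lo i + 1)
    (h2 : ∀ i < N, hi (i + 1) = lo i + 1 → lo (i + 1) ≤ lo i) :
    Nat.card (squareGrid.induce (s : Set (ℕ × ℕ))).ConnectedComponent =
      ((range (N + 1)).filter fun i => lo i < hi i ∧ (i < N → hi (i + 1) ≤ lo i)).card := by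
  set D := (range (N + 1)).filter fun i => lo i < hi i ∧ (i < N → hi (i + 1) ≤ lo i) with hD
  have hDs : ∀ i, i ∈ D ↔ (i, lo i) ∈ s ∧ (i < N → hi (i + 1) ≤ lo i) := by
    intro i
    rw [hD, mem_filter, mem_range, hs]
    constructor
    · rintro ⟨h3, h4, h5⟩
      exact ⟨⟨by omega, le_rfl, h4⟩, h5⟩
    · rintro ⟨⟨h3, _, h4⟩, h5⟩
      exact ⟨by omega, h4, h5⟩
  let f : D → (squareGrid.induce (s : Set (ℕ × ℕ))).ConnectedComponent := fun i =>
    SimpleGraph.connectedComponentMk _ ⟨(i.1, lo i.1), ((hDs i.1).1 i.2).1⟩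
  have hf : Function.Bijective f := by
    constructor
    · rintro ⟨a, ha⟩ ⟨b, hb⟩ hab
      have hr := SimpleGraph.ConnectedComponent.exact hab
      have h3 := row_le_of_reachable hs ((hDs a).1 ha).2 hr le_rfl
      have h4 := row_le_of_reachable hs ((hDs b).1 hb).2 hr.symm le_rfl
      exact Subtype.ext (le_antisymm h4 h3)
    · intro c
      induction c using SimpleGraph.ConnectedComponent.ind with
      | _ v =>
        obtain ⟨⟨i, j⟩, hv⟩ := v
        have h3 := (hs _ _).1 hv
        have h4 : (i, lo i) ∈ s := (hs _ _).2 ⟨h3.1, le_rfl, by omega⟩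
        obtain ⟨d, h5, h6, h7⟩ := exists_reachable_bottom_row hs h1 h2 (N - i) i (by omega) h4
        obtain ⟨c, hc⟩ := Nat.exists_eq_add_of_le h3.2.1
        subst hc
        refine ⟨⟨d, (hDs d).2 ⟨h5, h6⟩⟩, ?_⟩
        exact SimpleGraph.ConnectedComponent.sound (h7.trans (reachable_row_start hs h4 c hv).symm)
  rw [← Nat.card_eq_of_bijective f hf, Nat.card_eq_fintype_card, Fintype.card_coe]

end Components

/-! ### Shifted diagrams -/

theorem mem_shiftedCells {m : YoungDiagram} {i j : ℕ} :
    (i, j) ∈ shiftedCells m ↔ i ≤ j ∧ j < i + m.rowLen i := by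
  simp only [shiftedCells, mem_image, Prod.exists, Prod.mk.injEq, YoungDiagram.mem_cells]
  constructor
  · rintro ⟨a, b, h, rfl, rfl⟩
    rw [YoungDiagram.mem_iff_lt_rowLen] at h
    exact ⟨by omega, by omega⟩
  · rintro ⟨h1, h2⟩
    exact ⟨i, j - i, YoungDiagram.mem_iff_lt_rowLen.2 (by omega), rfl, by omega⟩

theorem card_shiftedCells (m : YoungDiagram) : (shiftedCells m).card = m.cells.card := by
  refine card_image_of_injective _ ?_
  rintro ⟨a, b⟩ ⟨c, d⟩ h
  simp only [Prod.mk.injEq] at h ⊢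
  omega

section Interlace

variable {n : ℕ} {m : YoungDiagram} {k : Fin n → ℕ}

theorem mem_shiftedCells_diagramOf (hk : Antitone k) {i j : ℕ} :
    (i, j) ∈ shiftedCells (diagramOf k) ↔ ∃ h : i < n, i ≤ j ∧ j < i + k ⟨i, h⟩ := by
  rw [mem_shiftedCells]
  constructor
  · rintro ⟨h1, h2⟩
    have h : i < n := by
      by_contra h
      rw [rowLen_diagramOf_eq_zero hk (by omega)] at h2
      omega
    exact ⟨h, h1, by rwa [← rowLen_diagramOf hk ⟨i, h⟩]⟩
  · rintro ⟨h, h1, h2⟩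
    exact ⟨h1, by rwa [← rowLen_diagramOf hk ⟨i, h⟩] at h2⟩

theorem mem_shiftedCells_of_mem_diagramOf
    (hi : ∀ i : Fin n, m.rowLen (i + 1) ≤ k i ∧ k i ≤ m.rowLen i)
    {c : ℕ × ℕ} (h : c ∈ shiftedCells (diagramOf k)) : c ∈ shiftedCells m := by
  obtain ⟨i, j⟩ := c
  obtain ⟨h1, h2, h3⟩ := (mem_shiftedCells_diagramOf (antitone_of_interlace_rowLen hi)).1 h
  have := (hi ⟨i, h1⟩).2
  exact mem_shiftedCells.2 ⟨h2, by simp only at this; omega⟩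

theorem add_le_of_strictAnti (hk : StrictAnti k) : ∀ (d i : ℕ) (h : i + d < n),
    k ⟨i + d, h⟩ + d ≤ k ⟨i, by omega⟩ := by
  intro d
  induction d with
  | zero => intro i h; exact le_rfl
  | succ d ih =>
    intro i h
    have h1 := ih i (by omega)
    have h2 : k ⟨i + (d + 1), h⟩ < k ⟨i + d, by omega⟩ := hk (by simp [Fin.lt_def])
    omega

/-- Strictness makes i + k i weakly decreasing, so the right ends of the shifted rows never move
right on the way down. -/
theorem mem_shiftedCells_diagramOf_of_col (hk : StrictAnti k) {i i' j : ℕ} (hii : i < i')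
    (h : (i', j) ∈ shiftedCells (diagramOf k)) : (i, j) ∈ shiftedCells (diagramOf k) := by
  obtain ⟨h1, h2, h3⟩ := (mem_shiftedCells_diagramOf hk.antitone).1 h
  obtain ⟨d, rfl⟩ := Nat.exists_eq_add_of_lt hii
  have := add_le_of_strictAnti hk (d + 1) i h1
  refine (mem_shiftedCells_diagramOf hk.antitone).2 ⟨by omega, by omega, ?_⟩
  simp only [add_assoc] at h3 this
  omega

/-- Diagonals of the shifted diagram are columns of the unshifted one, so this is the horizontal
strip property again. It yields strictness along diagonals in `extend`. -/
theorem mem_shiftedCells_diagramOf_of_diag (hm : m.rowLen (n + 1) = 0)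
    (hi : ∀ i : Fin n, m.rowLen (i + 1) ≤ k i ∧ k i ≤ m.rowLen i)
    {i j d : ℕ} (hd : 0 < d) (hij : i ≤ j) (h : (i + d, j + d) ∈ shiftedCells m) :
    (i, j) ∈ shiftedCells (diagramOf k) := by
  obtain ⟨h1, h2⟩ := mem_shiftedCells.1 h
  have := mem_diagramOf_of_lt (j := j - i) (i := i) hm hi (show i < i + d by omega)
    (YoungDiagram.mem_iff_lt_rowLen.2 (by omega))
  rw [YoungDiagram.mem_iff_lt_rowLen] at this
  exact mem_shiftedCells.2 ⟨hij, by omega⟩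

end Interlace

/-! ### Removing and adding the largest letter in shifted tableaux -/

namespace ShiftedTableau

variable {n : ℕ} {mu : YoungDiagram} {k : Fin n → ℕ}

theorem mem_strip {n : ℕ} {S : ShiftedTableau mu n} {a : Fin n} {c : ℕ × ℕ} :
    c ∈ S.strip a ↔ ∃ h : c ∈ shiftedCells mu, S.entry ⟨c, h⟩ = a := by
  simp [strip]

/-- The part of a shifted tableau filled with all letters but the largest one. -/
def restrict (S : ShiftedTableau mu (n + 1))
    (hS : ∀ c, c ∈ shiftedCells (diagramOf k) ↔
      ∃ h : c ∈ shiftedCells mu, (S.entry ⟨c, h⟩ : ℕ) < n) :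
    ShiftedTableau (diagramOf k) n where
  entry c := ⟨S.entry ⟨c, ((hS c).1 c.2).1⟩, ((hS c).1 c.2).2⟩
  row_weak _ _ h1 h2 := S.row_weak _ _ h1 h2
  col_weak _ _ h1 h2 := S.col_weak _ _ h1 h2
  diag_strict _ _ d h1 h2 := S.diag_strict _ _ d h1 h2

open Classical in
/-- Filling the boxes outside of a smaller shifted tableau with a new largest letter. -/
noncomputable def extend (S : ShiftedTableau (diagramOf k) n) (hm : mu.rowLen (n + 1) = 0)
    (hi : ∀ i : Fin n, mu.rowLen (i + 1) ≤ k i ∧ k i ≤ mu.rowLen i) (hk : StrictAnti k) :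
    ShiftedTableau mu (n + 1) where
  entry c := if h : c.1 ∈ shiftedCells (diagramOf k) then (S.entry ⟨c, h⟩).castSucc
    else Fin.last n
  row_weak := by
    rintro ⟨⟨i, j⟩, ha⟩ ⟨⟨i', j'⟩, hb⟩ h1 h2
    simp only at h1 h2 ⊢
    subst h1
    by_cases h3 : (i, j') ∈ shiftedCells (diagramOf k)
    · have h4 : (i, j) ∈ shiftedCells (diagramOf k) := by
        have := mem_shiftedCells.1 ha
        have := mem_shiftedCells.1 h3
        exact mem_shiftedCells.2 ⟨by omega, by omega⟩
      rw [dif_pos h3, dif_pos h4, Fin.castSucc_le_castSucc_iff]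
      exact S.row_weak _ _ rfl h2
    · rw [dif_neg h3]
      exact Fin.le_last _
  col_weak := by
    rintro ⟨⟨i, j⟩, ha⟩ ⟨⟨i', j'⟩, hb⟩ h1 h2
    simp only at h1 h2 ⊢
    subst h1
    by_cases h3 : (i', j) ∈ shiftedCells (diagramOf k)
    · rw [dif_pos h3, dif_pos (mem_shiftedCells_diagramOf_of_col hk h2 h3),
        Fin.castSucc_le_castSucc_iff]
      exact S.col_weak _ _ rfl h2
    · rw [dif_neg h3]
      exact Fin.le_last _
  diag_strict := by
    rintro ⟨⟨i, j⟩, ha⟩ ⟨⟨i', j'⟩, hb⟩ d h1 h2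
    simp only [Prod.mk.injEq] at h2 ⊢
    obtain ⟨rfl, rfl⟩ := h2
    rw [dif_pos (mem_shiftedCells_diagramOf_of_diag hm hi h1 (mem_shiftedCells.1 ha).1 hb)]
    by_cases h3 : (i + d, j + d) ∈ shiftedCells (diagramOf k)
    · rw [dif_pos h3, Fin.castSucc_lt_castSucc_iff]
      exact S.diag_strict _ _ d h1 rfl
    · rw [dif_neg h3]
      exact Fin.castSucc_lt_last _

theorem entry_extend_of_mem (S : ShiftedTableau (diagramOf k) n) (hm : mu.rowLen (n + 1) = 0)
    (hi : ∀ i : Fin n, mu.rowLen (i + 1) ≤ k i ∧ k i ≤ mu.rowLen i) (hk : StrictAnti k)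
    {c : ℕ × ℕ} (hc : c ∈ shiftedCells mu) (h : c ∈ shiftedCells (diagramOf k)) :
    (extend S hm hi hk).entry ⟨c, hc⟩ = (S.entry ⟨c, h⟩).castSucc := dif_pos h

theorem entry_extend_of_notMem (S : ShiftedTableau (diagramOf k) n) (hm : mu.rowLen (n + 1) = 0)
    (hi : ∀ i : Fin n, mu.rowLen (i + 1) ≤ k i ∧ k i ≤ mu.rowLen i) (hk : StrictAnti k)
    {c : ℕ × ℕ} (hc : c ∈ shiftedCells mu) (h : c ∉ shiftedCells (diagramOf k)) :
    (extend S hm hi hk).entry ⟨c, hc⟩ = Fin.last n := dif_neg h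

theorem mem_diagramOf_iff_extend (S : ShiftedTableau (diagramOf k) n)
    (hm : mu.rowLen (n + 1) = 0)
    (hi : ∀ i : Fin n, mu.rowLen (i + 1) ≤ k i ∧ k i ≤ mu.rowLen i) (hk : StrictAnti k)
    (c : ℕ × ℕ) : c ∈ shiftedCells (diagramOf k) ↔
      ∃ h : c ∈ shiftedCells mu, ((extend S hm hi hk).entry ⟨c, h⟩ : ℕ) < n := by
  constructor
  · intro h
    refine ⟨mem_shiftedCells_of_mem_diagramOf hi h, ?_⟩
    rw [entry_extend_of_mem S hm hi hk _ h]
    exact (S.entry ⟨c, h⟩).2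
  · rintro ⟨hc, h1⟩
    by_contra h
    rw [entry_extend_of_notMem S hm hi hk hc h] at h1
    exact lt_irrefl _ h1

theorem extend_restrict (S : ShiftedTableau mu (n + 1))
    (hS : ∀ c, c ∈ shiftedCells (diagramOf k) ↔
      ∃ h : c ∈ shiftedCells mu, (S.entry ⟨c, h⟩ : ℕ) < n)
    (hm : mu.rowLen (n + 1) = 0)
    (hi : ∀ i : Fin n, mu.rowLen (i + 1) ≤ k i ∧ k i ≤ mu.rowLen i) (hk : StrictAnti k) :
    extend (restrict S hS) hm hi hk = S := by
  ext ⟨c, hc⟩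
  by_cases h : c ∈ shiftedCells (diagramOf k)
  · rw [entry_extend_of_mem _ hm hi hk hc h]
    rfl
  · rw [entry_extend_of_notMem _ hm hi hk hc h]
    have h1 : ¬ (S.entry ⟨c, hc⟩ : ℕ) < n := fun h2 => h ((hS c).2 ⟨hc, h2⟩)
    have := (S.entry ⟨c, hc⟩).2
    simp only [Fin.val_last]
    omega

theorem restrict_extend (S : ShiftedTableau (diagramOf k) n) (hm : mu.rowLen (n + 1) = 0)
    (hi : ∀ i : Fin n, mu.rowLen (i + 1) ≤ k i ∧ k i ≤ mu.rowLen i) (hk : StrictAnti k) :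
    restrict (extend S hm hi hk) (mem_diagramOf_iff_extend S hm hi hk) = S := by
  ext ⟨c, hc⟩
  change ((extend S hm hi hk).entry ⟨c, _⟩ : ℕ) = _
  rw [entry_extend_of_mem S hm hi hk _ hc]
  rfl

theorem strip_extend_castSucc (S : ShiftedTableau (diagramOf k) n) (hm : mu.rowLen (n + 1) = 0)
    (hi : ∀ i : Fin n, mu.rowLen (i + 1) ≤ k i ∧ k i ≤ mu.rowLen i) (hk : StrictAnti k)
    (a : Fin n) : (extend S hm hi hk).strip a.castSucc = S.strip a := by
  ext c
  rw [mem_strip, mem_strip]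
  constructor
  · rintro ⟨hc, h⟩
    by_cases h1 : c ∈ shiftedCells (diagramOf k)
    · rw [entry_extend_of_mem S hm hi hk hc h1] at h
      exact ⟨h1, Fin.castSucc_injective _ h⟩
    · rw [entry_extend_of_notMem S hm hi hk hc h1] at h
      exact absurd h.symm (Fin.castSucc_lt_last a).ne
  · rintro ⟨h1, rfl⟩
    exact ⟨mem_shiftedCells_of_mem_diagramOf hi h1, entry_extend_of_mem S hm hi hk _ h1⟩

theorem strip_extend_last (S : ShiftedTableau (diagramOf k) n) (hm : mu.rowLen (n + 1) = 0)
    (hi : ∀ i : Fin n, mu.rowLen (i + 1) ≤ k i ∧ k i ≤ mu.rowLen i) (hk : StrictAnti k) :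
    (extend S hm hi hk).strip (Fin.last n) =
      shiftedCells mu \ shiftedCells (diagramOf k) := by
  ext c
  rw [mem_strip, mem_sdiff]
  constructor
  · rintro ⟨hc, h⟩
    refine ⟨hc, fun h1 => ?_⟩
    rw [entry_extend_of_mem S hm hi hk hc h1] at h
    exact absurd h (Fin.castSucc_lt_last _).ne
  · rintro ⟨hc, h⟩
    exact ⟨hc, entry_extend_of_notMem S hm hi hk hc h⟩

theorem wgt_extend_last (S : ShiftedTableau (diagramOf k) n) (hm : mu.rowLen (n + 1) = 0)
    (hi : ∀ i : Fin n, mu.rowLen (i + 1) ≤ k i ∧ k i ≤ mu.rowLen i) (hk : StrictAnti k) :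
    (extend S hm hi hk).wgt (Fin.last n) = mu.rowLen n + ∑ i : Fin n, (mu.rowLen i - k i) := by
  rw [wgt, strip_extend_last, card_sdiff_of_subset
    fun c hc => mem_shiftedCells_of_mem_diagramOf hi hc, card_shiftedCells, card_shiftedCells,
    card_sdiff_diagramOf hm hi, Nat.add_sub_cancel_left]

theorem mem_sdiff_shiftedCells (hm : mu.rowLen (n + 1) = 0) (i j : ℕ) :
    (i, j) ∈ shiftedCells mu \ shiftedCells (diagramOf k) ↔
      i ≤ n ∧ i + (diagramOf k).rowLen i ≤ j ∧ j < i + mu.rowLen i := by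
  rw [mem_sdiff, mem_shiftedCells, mem_shiftedCells]
  constructor
  · rintro ⟨h1, h2⟩
    refine ⟨?_, by omega, by omega⟩
    by_contra h
    have := mu.rowLen_anti (n + 1) i (by omega)
    omega
  · rintro ⟨h1, h2, h3⟩
    exact ⟨⟨by omega, h3⟩, by omega⟩

end ShiftedTableau

/-! ### Rows and components of the strip of the largest letter -/

namespace ShiftedTableau

variable {n : ℕ} {mu : YoungDiagram} {k : Fin n → ℕ}

/-- In row i the strip occupies the columns from i + k i to i + mu_i - 1, so a row is the bottom of
a component exactly when it is nonempty and mu_{i+1} < k i. The summand 1 is row n: it has no inner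
part, is nonempty, and has no strip boxes below it. -/
theorem con_extend_last (S : ShiftedTableau (diagramOf k) n) (hm : mu.rowLen (n + 1) = 0)
    (hi : ∀ i : Fin n, mu.rowLen (i + 1) ≤ k i ∧ k i ≤ mu.rowLen i) (hk : StrictAnti k)
    (hmu : ∀ i ≤ n, mu.rowLen (i + 1) < mu.rowLen i) :
    (extend S hm hi hk).con (Fin.last n) =
      (univ.filter fun i : Fin n => k i ≠ mu.rowLen i ∧ k i ≠ mu.rowLen (i + 1)).card + 1 := by
  have hr : ∀ i, (h : i < n) → (diagramOf k).rowLen i = k ⟨i, h⟩ := fun i h =>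
    rowLen_diagramOf hk.antitone ⟨i, h⟩
  have h0 : (diagramOf k).rowLen n = 0 := rowLen_diagramOf_eq_zero hk.antitone le_rfl
  unfold con
  rw [strip_extend_last, card_connectedComponent (N := n)
    (lo := fun i => i + (diagramOf k).rowLen i) (hi := fun i => i + mu.rowLen i)
    (mem_sdiff_shiftedCells hm), card_filter, sum_range_succ, sum_range, card_filter]
  · congr 1
    · refine sum_congr rfl fun i _ => ?_
      have h1 := hi i
      have h2 := i.2
      refine if_congr ?_ rfl rfl
      rw [rowLen_diagramOf hk.antitone i]
      omega
    · rw [if_pos]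
      have := hmu n le_rfl
      omega
  · intro i h
    have := (hi ⟨i, h⟩).1
    rw [hr i h]
    simp only at this
    omega
  · intro i h h2
    rw [hr i h] at h2 ⊢
    have h3 := hmu (i + 1) h
    by_cases h4 : i + 1 < n
    · have : k ⟨i + 1, h4⟩ < k ⟨i, h⟩ := hk (by simp [Fin.lt_def])
      rw [hr _ h4]
      omega
    -- Here i + 1 = n and the inner row is empty, so k i = mu_n > 0 replaces the strict decrease of
    -- k.
    · rw [rowLen_diagramOf_eq_zero hk.antitone (by omega)]
      omega

theorem row_extend_last (S : ShiftedTableau (diagramOf k) n) (hm : mu.rowLen (n + 1) = 0)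
    (hi : ∀ i : Fin n, mu.rowLen (i + 1) ≤ k i ∧ k i ≤ mu.rowLen i) (hk : StrictAnti k)
    (hmu : ∀ i ≤ n, mu.rowLen (i + 1) < mu.rowLen i) :
    (extend S hm hi hk).row (Fin.last n) =
      (univ.filter fun i : Fin n => k i ≠ mu.rowLen i).card + 1 := by
  have h0 : (diagramOf k).rowLen n = 0 := rowLen_diagramOf_eq_zero hk.antitone le_rfl
  have e : (shiftedCells mu \ shiftedCells (diagramOf k)).image Prod.fst =
      (range (n + 1)).filter fun i => (diagramOf k).rowLen i < mu.rowLen i := by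
    ext i
    simp only [mem_image, Prod.exists, mem_filter, mem_range]
    constructor
    · rintro ⟨a, b, h, rfl⟩
      have := (mem_sdiff_shiftedCells hm a b).1 h
      omega
    · rintro ⟨h1, h2⟩
      exact ⟨i, _, (mem_sdiff_shiftedCells hm i _).2 ⟨by omega, le_rfl, by omega⟩, rfl⟩
  rw [row, strip_extend_last, e, card_filter, sum_range_succ, sum_range, card_filter]
  congr 1
  · refine sum_congr rfl fun i _ => ?_
    rw [rowLen_diagramOf hk.antitone i]
    refine if_congr ?_ rfl rfl
    have := hi i
    omega
  · rw [if_pos]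
    have := hmu n le_rfl
    omega

/-- A nonempty row that is not the bottom of a component is one with k i = mu_{i+1}. Since mu_{i+1}
< mu_i, such a row is automatically nonempty. -/
theorem row_extend_last_eq_con_add (S : ShiftedTableau (diagramOf k) n)
    (hm : mu.rowLen (n + 1) = 0)
    (hi : ∀ i : Fin n, mu.rowLen (i + 1) ≤ k i ∧ k i ≤ mu.rowLen i) (hk : StrictAnti k)
    (hmu : ∀ i ≤ n, mu.rowLen (i + 1) < mu.rowLen i) :
    (extend S hm hi hk).row (Fin.last n) = (extend S hm hi hk).con (Fin.last n) +
      (univ.filter fun i : Fin n => k i = mu.rowLen (i + 1)).card := by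
  rw [con_extend_last S hm hi hk hmu, row_extend_last S hm hi hk hmu, card_filter, card_filter,
    card_filter, add_right_comm, ← sum_add_distrib]
  congr 1
  refine sum_congr rfl fun i _ => ?_
  have := hmu i i.2.le
  split_ifs <;> omega

theorem prod_ribbonFactor {R : Type*} [CommRing R] (t y : R)
    (hmu : ∀ i ≤ n, mu.rowLen (i + 1) < mu.rowLen i) :
    ∏ i : Fin n, ribbonFactor t y (mu.rowLen (i + 1)) (mu.rowLen i) (k i) =
      t ^ (univ.filter fun i : Fin n => k i = mu.rowLen (i + 1)).card *
      (1 + t) ^ (univ.filter fun i : Fin n => k i ≠ mu.rowLen i ∧ k i ≠ mu.rowLen (i + 1)).card *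
      y ^ ∑ i : Fin n, (mu.rowLen i - k i) := by
  simp only [ribbonFactor]
  have hpow : ∀ (c : R) (p : Fin n → Prop) [DecidablePred p],
      c ^ (univ.filter p).card = ∏ i, if p i then c else 1 := fun c p _ => by
    rw [prod_ite, prod_const, prod_const_one, mul_one]
  rw [prod_mul_distrib, prod_pow_eq_pow_sum, hpow, hpow, ← prod_mul_distrib]
  congr 1
  refine prod_congr rfl fun i _ => ?_
  have := hmu i i.2.le
  by_cases h1 : k i = mu.rowLen i
  · have h2 : k i ≠ mu.rowLen (i + 1) := by omega
    simp [h1, this.ne']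
  · by_cases h2 : k i = mu.rowLen (i + 1)
    · simp [h2, this.ne]
    · simp [h1, h2]

open Classical in
/-- The lengths of the rows of the part of `S` without the largest letter. -/
noncomputable def innerShape (S : ShiftedTableau mu (n + 1)) (i : Fin n) : ℕ :=
  ((range (mu.rowLen i)).filter fun j =>
    ∃ h : ((i : ℕ), (i : ℕ) + j) ∈ shiftedCells mu, (S.entry ⟨_, h⟩ : ℕ) < n).card

theorem lt_innerShape_iff (S : ShiftedTableau mu (n + 1)) (i : Fin n) (j : ℕ) :
    j < S.innerShape i ↔
      ∃ h : ((i : ℕ), (i : ℕ) + j) ∈ shiftedCells mu, (S.entry ⟨_, h⟩ : ℕ) < n := by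
  unfold innerShape
  rw [lt_card_filter_range_iff]
  · refine ⟨fun h => h.2, fun h => ⟨?_, h⟩⟩
    obtain ⟨h1, _⟩ := h
    have := mem_shiftedCells.1 h1
    omega
  · rintro a b h1 h2 ⟨h3, h4⟩
    have h5 : ((i : ℕ), (i : ℕ) + a) ∈ shiftedCells mu := mem_shiftedCells.2 ⟨by omega, by omega⟩
    refine ⟨h5, ?_⟩
    rcases h1.eq_or_lt with rfl | h6
    · exact h4
    · have := S.row_weak ⟨_, h5⟩ ⟨_, h3⟩ rfl (by simpa using h6)
      rw [Fin.le_def] at this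
      omega

theorem innerShape_interlace (S : ShiftedTableau mu (n + 1)) (i : Fin n) :
    mu.rowLen (i + 1) ≤ S.innerShape i ∧ S.innerShape i ≤ mu.rowLen i := by
  constructor
  · refine le_of_forall_lt fun j hj => ?_
    rw [lt_innerShape_iff]
    have h1 : ((i : ℕ) + 1, (i : ℕ) + j + 1) ∈ shiftedCells mu :=
      mem_shiftedCells.2 ⟨by omega, by omega⟩
    have h2 : ((i : ℕ), (i : ℕ) + j) ∈ shiftedCells mu :=
      mem_shiftedCells.2 ⟨by omega, by have := mu.rowLen_anti i (i + 1) (by omega); omega⟩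
    refine ⟨h2, ?_⟩
    have := S.diag_strict ⟨_, h2⟩ ⟨_, h1⟩ 1 one_pos rfl
    rw [Fin.lt_def] at this
    have := (S.entry ⟨_, h1⟩).2
    omega
  · refine le_of_forall_lt fun j hj => ?_
    obtain ⟨h, _⟩ := (lt_innerShape_iff S i j).1 hj
    have := mem_shiftedCells.1 h
    omega

/-- The box in position j of row i + 1 lies below position j + 1 of row i. By weak increase down
columns, a smaller letter in the former forces one in the latter, so row i has more of them. If row
i had none, interlacing would give mu_{i+1} = 0, contrary to strictness of mu. -/
theorem innerShape_strictAnti (S : ShiftedTableau mu (n + 1))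
    (hmu : ∀ i ≤ n, mu.rowLen (i + 1) < mu.rowLen i) : StrictAnti S.innerShape := by
  cases n with
  | zero => exact fun i => i.elim0
  | succ n =>
    rw [Fin.strictAnti_iff_succ_lt]
    intro i
    by_contra! h
    cases hj : S.innerShape i.castSucc with
    | zero =>
      have h1 := (S.innerShape_interlace i.castSucc).1
      have h2 := hmu (i + 1) (by omega)
      simp only [Fin.val_castSucc] at h1
      omega
    | succ j =>
      have h1 : j < S.innerShape i.succ := by omega
      obtain ⟨h2, h3⟩ := (lt_innerShape_iff S _ _).1 h1
      have h2' : ((i : ℕ) + 1, (i : ℕ) + 1 + j) ∈ shiftedCells mu := by simpa using h2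
      have h3' : (S.entry ⟨_, h2'⟩ : ℕ) < n + 1 := by simpa using h3
      have h4 : ((i.castSucc : ℕ), (i.castSucc : ℕ) + (j + 1)) ∈ shiftedCells mu := by
        have := mem_shiftedCells.1 h2'
        have := hmu i (by omega)
        simp only [Fin.val_castSucc]
        exact mem_shiftedCells.2 ⟨by omega, by omega⟩
      have h5 := S.col_weak ⟨_, h4⟩ ⟨_, h2'⟩ (by simp only [Fin.val_castSucc]; omega) (by simp)
      rw [Fin.le_def] at h5
      have := (lt_innerShape_iff S i.castSucc (j + 1)).2 ⟨h4, by omega⟩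
      omega

/-- Each box of row i ends a diagonal run of i + 1 boxes starting in row 0, along which the entries
increase strictly. For i = n this shows that row n holds only the largest letter. -/
theorem le_entry (S : ShiftedTableau mu n) {i j : ℕ} (h : (i, j) ∈ shiftedCells mu) :
    i ≤ S.entry ⟨_, h⟩ := by
  induction i generalizing j with
  | zero => exact Nat.zero_le _
  | succ i ih =>
    have h1 := mem_shiftedCells.1 h
    obtain ⟨j, rfl⟩ : ∃ c, j = c + 1 := ⟨j - 1, by omega⟩
    have h2 : (i, j) ∈ shiftedCells mu :=
      mem_shiftedCells.2 ⟨by omega, by have := mu.rowLen_anti i (i + 1) (by omega); omega⟩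
    have h3 := S.diag_strict ⟨_, h2⟩ ⟨_, h⟩ 1 one_pos rfl
    have := ih h2
    rw [Fin.lt_def] at h3
    omega

theorem mem_diagramOf_innerShape (S : ShiftedTableau mu (n + 1)) (hk : Antitone k)
    (h : S.innerShape = k) (c : ℕ × ℕ) : c ∈ shiftedCells (diagramOf k) ↔
      ∃ h : c ∈ shiftedCells mu, (S.entry ⟨c, h⟩ : ℕ) < n := by
  subst h
  obtain ⟨i, j⟩ := c
  rw [mem_shiftedCells_diagramOf hk]
  constructor
  · rintro ⟨h1, h2, h3⟩
    obtain ⟨c, rfl⟩ := Nat.exists_eq_add_of_le h2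
    exact (lt_innerShape_iff S ⟨i, h1⟩ c).1 (by omega)
  · rintro ⟨h1, h2⟩
    have h3 := S.le_entry h1
    have h4 := mem_shiftedCells.1 h1
    obtain ⟨c, rfl⟩ := Nat.exists_eq_add_of_le h4.1
    have := (lt_innerShape_iff S ⟨i, by omega⟩ c).2 ⟨h1, h2⟩
    exact ⟨by omega, by omega, by omega⟩

theorem innerShape_extend (S : ShiftedTableau (diagramOf k) n) (hm : mu.rowLen (n + 1) = 0)
    (hi : ∀ i : Fin n, mu.rowLen (i + 1) ≤ k i ∧ k i ≤ mu.rowLen i) (hk : StrictAnti k) :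
    (extend S hm hi hk).innerShape = k := by
  ext i
  refine eq_of_forall_lt_iff fun j => ?_
  rw [lt_innerShape_iff, ← mem_diagramOf_iff_extend S hm hi hk,
    mem_shiftedCells_diagramOf hk.antitone]
  exact ⟨fun ⟨_, _, h⟩ => by simpa using h, fun h => ⟨i.2, by omega, by simpa using h⟩⟩

theorem con_extend_castSucc (S : ShiftedTableau (diagramOf k) n) (hm : mu.rowLen (n + 1) = 0)
    (hi : ∀ i : Fin n, mu.rowLen (i + 1) ≤ k i ∧ k i ≤ mu.rowLen i) (hk : StrictAnti k)
    (a : Fin n) : (extend S hm hi hk).con a.castSucc = S.con a := by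
  unfold con
  rw [strip_extend_castSucc]

theorem row_extend_castSucc (S : ShiftedTableau (diagramOf k) n) (hm : mu.rowLen (n + 1) = 0)
    (hi : ∀ i : Fin n, mu.rowLen (i + 1) ≤ k i ∧ k i ≤ mu.rowLen i) (hk : StrictAnti k)
    (a : Fin n) : (extend S hm hi hk).row a.castSucc = S.row a := by
  unfold row
  rw [strip_extend_castSucc]

theorem str_extend (S : ShiftedTableau (diagramOf k) n) (hm : mu.rowLen (n + 1) = 0)
    (hi : ∀ i : Fin n, mu.rowLen (i + 1) ≤ k i ∧ k i ≤ mu.rowLen i) (hk : StrictAnti k)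
    (hmu : ∀ i ≤ n, mu.rowLen (i + 1) < mu.rowLen i) :
    (extend S hm hi hk).str = S.str +
      ((univ.filter fun i : Fin n => k i ≠ mu.rowLen i ∧ k i ≠ mu.rowLen (i + 1)).card + 1) := by
  rw [str, Fin.sum_univ_castSucc, con_extend_last S hm hi hk hmu, str]
  simp only [con_extend_castSucc]

theorem hgt_extend (S : ShiftedTableau (diagramOf k) n) (hm : mu.rowLen (n + 1) = 0)
    (hi : ∀ i : Fin n, mu.rowLen (i + 1) ≤ k i ∧ k i ≤ mu.rowLen i) (hk : StrictAnti k)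
    (hmu : ∀ i ≤ n, mu.rowLen (i + 1) < mu.rowLen i) :
    (extend S hm hi hk).hgt = S.hgt +
      (univ.filter fun i : Fin n => k i = mu.rowLen (i + 1)).card := by
  rw [hgt, Fin.sum_univ_castSucc, row_extend_last_eq_con_add S hm hi hk hmu, hgt]
  simp only [con_extend_castSucc, row_extend_castSucc]
  push_cast
  ring

/-- Every shifted tableau of length `n + 1` arises by adding a ribbon strip of the largest letter
to a smaller shifted tableau. -/
theorem exists_eq_extend (S : ShiftedTableau mu (n + 1)) (hm : mu.rowLen (n + 1) = 0)
    (hmu : ∀ i ≤ n, mu.rowLen (i + 1) < mu.rowLen i) :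
    ∃ (k : Fin n → ℕ) (hi : ∀ i : Fin n, mu.rowLen (i + 1) ≤ k i ∧ k i ≤ mu.rowLen i)
      (hk : StrictAnti k) (S' : ShiftedTableau (diagramOf k) n), S = extend S' hm hi hk :=
  ⟨S.innerShape, S.innerShape_interlace, S.innerShape_strictAnti hmu, _,
    (S.extend_restrict (S.mem_diagramOf_innerShape (S.innerShape_strictAnti hmu).antitone rfl)
      hm _ _).symm⟩

end ShiftedTableau

/-! ### The generating function of shifted tableaux and the conclusion -/

theorem diagramOf_strict {n : ℕ} {k : Fin n → ℕ} (hk : StrictAnti k) (hpos : ∀ i, 0 < k i) :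
    ∀ i < n, (diagramOf k).rowLen (i + 1) < (diagramOf k).rowLen i := by
  intro i h
  rw [rowLen_diagramOf hk.antitone ⟨i, h⟩]
  by_cases h1 : i + 1 < n
  · rw [rowLen_diagramOf hk.antitone ⟨i + 1, h1⟩]
    exact hk (by simp [Fin.lt_def])
  · rw [rowLen_diagramOf_eq_zero hk.antitone (by omega)]
    exact hpos _

/-- Each added strip raises `hgt` by a number of rows and `str` by at least the one component
containing row n. -/
theorem hgt_nonneg_and_le_str (n : ℕ) : ∀ (mu : YoungDiagram) (_ : mu.rowLen n = 0)
    (_ : ∀ i < n, mu.rowLen (i + 1) < mu.rowLen i) (S : ShiftedTableau mu n),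
    0 ≤ S.hgt ∧ n ≤ S.str := by
  induction n with
  | zero => exact fun mu _ _ S => ⟨by simp [ShiftedTableau.hgt], Nat.zero_le _⟩
  | succ n ih =>
    intro mu hm hmu S
    have hmu' : ∀ i ≤ n, mu.rowLen (i + 1) < mu.rowLen i := fun i h => hmu i (by omega)
    obtain ⟨k, hi, hk, S, rfl⟩ := S.exists_eq_extend hm hmu'
    rw [S.hgt_extend hm hi hk hmu', S.str_extend hm hi hk hmu']
    have hpos : ∀ i, 0 < k i := fun i => by
      have := hi i; have := hmu (i + 1) (by omega); omega
    have := ih _ (rowLen_diagramOf_eq_zero hk.antitone le_rfl) (diagramOf_strict hk hpos) S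
    omega

theorem sum_shiftedTableau_eq_branchShifted {R : Type*} [CommRing R] (t : R) (n : ℕ) :
    ∀ (mu : YoungDiagram) (_ : mu.rowLen n = 0)
    (_ : ∀ i < n, mu.rowLen (i + 1) < mu.rowLen i) (x : Fin n → R),
    ∑ S : ShiftedTableau mu n, t ^ S.hgt.toNat * (1 + t) ^ (S.str - n) * ∏ k, x k ^ S.wgt k =
      branchShifted t n (fun i => mu.rowLen i) x := by
  induction n with
  | zero =>
    intro mu h _ x
    have h0 : ∀ c, c ∉ shiftedCells mu := by
      rintro ⟨i, j⟩ hc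
      have := mu.rowLen_anti 0 i (Nat.zero_le i)
      have := mem_shiftedCells.1 hc
      omega
    have : Fintype.card (ShiftedTableau mu 0) = 1 := by
      refine Fintype.card_eq_one_iff.2 ⟨⟨fun c => (h0 _ c.2).elim, fun c => (h0 _ c.2).elim,
        fun c => (h0 _ c.2).elim, fun c => (h0 _ c.2).elim⟩, fun S => ?_⟩
      ext c
      exact (h0 _ c.2).elim
    simp [branchShifted, this, ShiftedTableau.hgt, ShiftedTableau.str]
  | succ n ih =>
    intro mu hm hmu x
    have hmu' : ∀ i ≤ n, mu.rowLen (i + 1) < mu.rowLen i := fun i h => hmu i (by omega)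
    classical
    rw [branchShifted, ← sum_fiberwise_of_maps_to (g := ShiftedTableau.innerShape)
      (t := (Fintype.piFinset fun i : Fin n => Icc (mu.rowLen (i.succ : Fin (n + 1)))
        (mu.rowLen (i.castSucc : Fin (n + 1)))).filter StrictAnti)]
    · refine sum_congr (by congr!) fun k hk' => ?_
      obtain ⟨hi, hk⟩ : (∀ i : Fin n, mu.rowLen (i + 1) ≤ k i ∧ k i ≤ mu.rowLen i) ∧
          StrictAnti k := by
        simpa only [mem_filter, Fintype.mem_piFinset, mem_Icc, Fin.val_succ, Fin.val_castSucc]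
          using hk'
      have hpos : ∀ i, 0 < k i := fun i => by
        have := hi i; have := hmu (i + 1) (by omega); omega
      have hd0 := rowLen_diagramOf_eq_zero hk.antitone le_rfl
      have hds := diagramOf_strict hk hpos
      have e : branchShifted t n k (fun i => x i.castSucc) =
          branchShifted t n (fun i => (diagramOf k).rowLen i) fun i => x i.castSucc := by
        congr 1
        ext i
        rw [rowLen_diagramOf hk.antitone]
      rw [e, ← ih _ hd0 hds, mul_sum]
      have hS : ∀ S ∈ univ.filter (fun S : ShiftedTableau mu (n + 1) => S.innerShape = k),
          ∀ c, c ∈ shiftedCells (diagramOf k) ↔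
            ∃ h : c ∈ shiftedCells mu, (S.entry ⟨c, h⟩ : ℕ) < n := fun S hS =>
        S.mem_diagramOf_innerShape hk.antitone (mem_filter.1 hS).2
      refine sum_bij' (fun S h => S.restrict (hS S h)) (fun S _ => S.extend hm hi hk)
        (fun _ _ => mem_univ _)
        (fun S _ => mem_filter.2 ⟨mem_univ _, S.innerShape_extend hm hi hk⟩)
        (fun S h => S.extend_restrict (hS S h) hm hi hk)
        (fun S _ => S.restrict_extend hm hi hk) fun S h => ?_
      conv_lhs => rw [← S.extend_restrict (hS S h) hm hi hk]
      generalize S.restrict (hS S h) = S'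
      -- The bounds for the smaller tableau make `toNat` and the truncated subtraction of n additive
      -- when the strip is added.
      obtain ⟨h1, h2⟩ := hgt_nonneg_and_le_str n _ hd0 hds S'
      have e1 := S'.hgt_extend hm hi hk hmu'
      have e2 := S'.str_extend hm hi hk hmu'
      set A := (univ.filter fun i : Fin n => k i = mu.rowLen (i + 1)).card with hA
      set B := (univ.filter fun i : Fin n =>
        k i ≠ mu.rowLen i ∧ k i ≠ mu.rowLen (i + 1)).card with hB
      rw [show (S'.extend hm hi hk).hgt.toNat = S'.hgt.toNat + A by omega,
        show (S'.extend hm hi hk).str - (n + 1) = (S'.str - n) + B by omega,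
        Fin.prod_univ_castSucc, S'.wgt_extend_last]
      simp only [Fin.val_last, Fin.val_castSucc, Fin.val_succ]
      rw [ShiftedTableau.prod_ribbonFactor t _ hmu', ← hA, ← hB, pow_add, pow_add, pow_add]
      simp only [ShiftedTableau.wgt, ShiftedTableau.strip_extend_castSucc]
      ring
    · intro S _
      simp only [mem_filter, Fintype.mem_piFinset, mem_Icc, Fin.val_succ, Fin.val_castSucc]
      exact ⟨S.innerShape_interlace, S.innerShape_strictAnti hmu'⟩

theorem mainTheorem5 {R : Type*} [CommRing R] (n : ℕ) (lam mu : YoungDiagram)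
    (hlam : lam.colLen 0 ≤ n)
    (hmu : ∀ i, mu.rowLen i = lam.rowLen i + (n - i))
    (x : Fin n → R) (t : R) :
    (∀ S : ShiftedTableau mu n, 0 ≤ S.hgt ∧ n ≤ S.str) ∧
    (∏ i, x i) * (∏ i, ∏ j ∈ Finset.Ioi i, (x i + t * x j)) * schur lam x =
      ∑ S : ShiftedTableau mu n,
        t ^ S.hgt.toNat * (1 + t) ^ (S.str - n) * ∏ k, x k ^ S.wgt k := by
  have hl : lam.rowLen n = 0 := by
    by_contra h
    have := YoungDiagram.mem_iff_lt_colLen.1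
      (YoungDiagram.mem_iff_lt_rowLen.2 (Nat.pos_of_ne_zero h))
    omega
  have hm : mu.rowLen n = 0 := by rw [hmu, hl]; omega
  have hs : ∀ i < n, mu.rowLen (i + 1) < mu.rowLen i := by
    intro i h
    have := lam.rowLen_anti i (i + 1) (by omega)
    rw [hmu, hmu]
    omega
  refine ⟨hgt_nonneg_and_le_str n mu hm hs, ?_⟩
  rw [sum_shiftedTableau_eq_branchShifted t n mu hm hs, schur_eq_branchSchur n lam hl,
    branchShifted_eq t n x _ fun i j h => lam.rowLen_anti i j h]
  simp only [hmu]
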